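/- Let $M$ be a smooth surface (a two-dimensional $C^\infty$ manifold without boundary, Hausdorff and second countable, not necessarily compact or connected), let $\mathbf r\colon M\to\mathbb R^3$ be a smooth immersion with a smooth unit normal field $\mathbf N$, and let $F=F(H,K)\in C^3(\mathbb R^2)$. Equip $M$ with the induced metric $g=\langle\cdot,\cdot\rangle$, its Levi-Civita connection $\nabla$ and its area element $dV$. Let $A=-d\mathbf N$ be the Weingarten operator, $h(X,Y)=\langle AX,Y\rangle$ the scalar second fundamental form, $H=\frac12\operatorname{tr}A$ the mean curvature and $K=\det A$ the Gaussian curvature. Let $\Delta f=\operatorname{tr}_g\operatorname{Hess}_f$, and let $\nabla^*B=-\sum_i(\nabla_{e_i}B)(e_i,\cdot)$ ($(e_i)$ a local orthonormal frame) for a $1$- or $2$-tensor $B$, so that $(\nabla^*)^2B=\nabla^*(\nabla^*B)$ is a function when $B$ is a $2$-tensor. Write $F'_H,F'_K$ for the partial derivatives of $F$, evaluated, like $F$, at $(H,K)$, and set $$E=\Delta\Big(\tfrac12F'_H+2HF'_K\Big)-(\nabla^*)^2(F'_K\,h)+(2H^2-K)F'_H+2HK\,F'_K-2HF .$$ For a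 smooth function $u\colon M\to\mathbb R$ with compact support consider the variation $\mathbf r_t=\mathbf r+t\,u\,\mathbf N$, an immersion for small $|t|$, with the unit normal that continues $\mathbf N$, and let $H_t,K_t,dV_t$ be its mean curvature, Gaussian curvature and area element. Then for every such $u$ and every compact set $C\subseteq M$ containing the support of $u$, $$\frac{d}{dt}\Big|_{t=0}\int_C F(H_t,K_t)\,dV_t=\int_M u\,E\,dV .$$ Consequently, the Euler–Lagrange equation of the functional $\int_M F(H,K)\,dV$ is $E=0$: the immersion $\mathbf r$ is critical, that is, the above derivative exists and is zero for all such $u$ and $C$, if and only if $$\Delta\Big(\tfrac12F'_H+2HF'_K\Big)-(\nabla^*)^2(F'_K\,h)+(2H^2-K)F'_H+2HK\,F'_K-2HF=0\quad\text{on } M .$$ -/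

import Mathlib

open scoped Manifold ContDiff InnerProductSpace
open MeasureTheory

noncomputable section

namespace ImmersedSurface

/-- The model plane of a surface. -/
abbrev Plane := EuclideanSpace ℝ (Fin 2)

/-- The ambient Euclidean space `ℝ³`. -/
abbrev Space := EuclideanSpace ℝ (Fin 3)

section

variable {M : Type*} [TopologicalSpace M] [ChartedSpace Plane M]
variable {V : Type*} [NormedAddCommGroup V] [NormedSpace ℝ V]

/-! Everything below is for a map `r : M → ℝ³` (meant to be an immersion) of a surface `M`.
A vector tangent to `M` at `p` is represented either by an element of `T_p M` (the model plane) or by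
its image under `dr_p` in `ℝ³`; a tangent vector field is represented by a map `M → ℝ³`, and a
2-tensor `B` by the endomorphism `B♯` of `ℝ³` that is tangential (zero on the normal, with values
in the tangent plane), `B(X, Y) = ⟪B♯ X, Y⟫`. -/

/-- The differential `df_p : T_p M → V` of a vector valued function. -/
def diff (f : M → V) (p : M) : Plane →L[ℝ] V :=
  mfderiv (𝓡 2) 𝓘(ℝ, V) f p

/-- `r` is an immersion of class `C^∞`. -/
def IsSmoothImmersion (r : M → Space) : Prop :=
  ContMDiff (𝓡 2) 𝓘(ℝ, Space) ∞ r ∧ ∀ p, Function.Injective (diff r p)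

/-- `N` is a smooth unit normal vector field along `r`. -/
def IsUnitNormal (r N : M → Space) : Prop :=
  ContMDiff (𝓡 2) 𝓘(ℝ, Space) ∞ N ∧ (∀ p, ‖N p‖ = 1) ∧ ∀ p X, ⟪N p, diff r p X⟫_ℝ = 0

/-- The tangent plane `dr_p (T_p M) ⊆ ℝ³`. -/
def tangentPlane (r : M → Space) (p : M) : Submodule ℝ Space :=
  LinearMap.range (diff r p).toLinearMap

/-- Orthogonal projection of `ℝ³` onto the tangent plane. -/
def tanProj (r : M → Space) (p : M) : Space →L[ℝ] Space :=
  (tangentPlane r p).starProjection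

/-- The map `ℝ³ → T_p M`, `(dr* dr)⁻¹ dr*`: for injective `dr_p` it is the left inverse of `dr_p`
that vanishes on the orthogonal complement of the tangent plane. -/
def pullTangent (r : M → Space) (p : M) : Space →L[ℝ] Plane :=
  ((ContinuousLinearMap.adjoint (diff r p)) ∘L (diff r p)).inverse ∘L
    ContinuousLinearMap.adjoint (diff r p)

/-- Derivative of `f` in tangential directions, as a linear map on `ℝ³` which is `df_p ∘ (dr_p)⁻¹` on
the tangent plane and `0` on the normal line. -/
def tderiv (r : M → Space) (f : M → V) (p : M) : Space →L[ℝ] V :=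
  diff f p ∘L pullTangent r p

/-- The Weingarten operator `A = -dN` on `T_p M`, that is, `dr (A X) = - dN X`. -/
def weingarten (r N : M → Space) (p : M) : Plane →L[ℝ] Plane :=
  -(pullTangent r p ∘L diff N p)

/-- The mean curvature `H = ½ tr A`. -/
def meanCurv (r N : M → Space) (p : M) : ℝ :=
  (1 / 2) * LinearMap.trace ℝ Plane (weingarten r N p).toLinearMap

/-- The Gaussian curvature `K = det A`. -/
def gaussCurv (r N : M → Space) (p : M) : ℝ :=
  LinearMap.det (weingarten r N p).toLinearMap

/-- The scalar second fundamental form `h(X, Y) = ⟪A X, Y⟫`, represented by `h♯ = A` on the tangent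
plane in `ℝ³`. -/
def secondForm (r N : M → Space) (p : M) : Space →L[ℝ] Space :=
  -tderiv r N p

/-- The Levi-Civita connection of the induced metric: `∇_X Y` is the tangential part of the derivative
of the tangent field `Y : M → ℝ³` in the direction `X`. Here `covDeriv r Y p X = ∇_X Y`. -/
def covDeriv (r : M → Space) (Y : M → Space) (p : M) : Space →L[ℝ] Space :=
  tanProj r p ∘L tderiv r Y p

/-- The gradient: `⟪∇f, X⟫ = df(X)`. -/
def grad (r : M → Space) (f : M → ℝ) (p : M) : Space :=
  (InnerProductSpace.toDual ℝ Space).symm (tderiv r f p)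

/-- The Hessian `Hess_f(X, Y) = ⟪∇_X ∇f, Y⟫`. -/
def hess (r : M → Space) (f : M → ℝ) (p : M) : Space →L[ℝ] Space :=
  covDeriv r (grad r f) p

/-- The Laplacian `Δ f = tr Hess_f`. -/
def laplacian (r : M → Space) (f : M → ℝ) (p : M) : ℝ :=
  LinearMap.trace ℝ Space (hess r f p).toLinearMap

/-- The covariant derivative of a 2-tensor: `(∇_X B)(Y, Z) = ⟪(D_X B♯) Y, Z⟫` on tangent vectors. -/
def covDerivTensor (r : M → Space) (B : M → Space →L[ℝ] Space) (p : M) (X : Space) :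
    Space →L[ℝ] Space :=
  tanProj r p ∘L (tderiv r B p X) ∘L tanProj r p

/-- `∇* B = - ∑ (∇_{e_i} B)(e_i, ·)` for a 2-tensor, as a tangent vector field. The sum over an
orthonormal basis of the tangent plane may be taken over an orthonormal basis of `ℝ³`, since the
bilinear expression vanishes on normal vectors. -/
def adjTensor (r : M → Space) (B : M → Space →L[ℝ] Space) (p : M) : Space :=
  -∑ i : Fin 3, covDerivTensor r B p (EuclideanSpace.single i 1) (EuclideanSpace.single i 1)

/-- `∇* Y = - ∑ ⟪∇_{e_i} Y, e_i⟫` for a tangent vector field (1-form). -/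
def adjField (r : M → Space) (Y : M → Space) (p : M) : ℝ :=
  -LinearMap.trace ℝ Space (covDeriv r Y p).toLinearMap

/-- `(∇*)² B = ∇*(∇* B)` for a 2-tensor `B`. -/
def adjSq (r : M → Space) (B : M → Space →L[ℝ] Space) (p : M) : ℝ :=
  adjField r (adjTensor r B) p

/-- Partial derivative of `F(H, K)` in `H`. -/
def partialH (F : ℝ × ℝ → ℝ) (x : ℝ × ℝ) : ℝ := fderiv ℝ F x (1, 0)

/-- Partial derivative of `F(H, K)` in `K`. -/
def partialK (F : ℝ × ℝ → ℝ) (x : ℝ × ℝ) : ℝ := fderiv ℝ F x (0, 1)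

/-- The pair `(H, K)` as a function on the surface. -/
def curvatures (r N : M → Space) (p : M) : ℝ × ℝ := (meanCurv r N p, gaussCurv r N p)

/-- The left-hand side of the Euler-Lagrange equation,
`Δ(½ F_H + 2 H F_K) - (∇*)²(F_K h) + (2 H² - K) F_H + 2 H K F_K - 2 H F`. -/
def eulerLagrange (F : ℝ × ℝ → ℝ) (r N : M → Space) (p : M) : ℝ :=
  laplacian r (fun q => (1 / 2) * partialH F (curvatures r N q)
      + 2 * meanCurv r N q * partialK F (curvatures r N q)) p
    - adjSq r (fun q => partialK F (curvatures r N q) • secondForm r N q) p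
    + (2 * meanCurv r N p ^ 2 - gaussCurv r N p) * partialH F (curvatures r N p)
    + 2 * meanCurv r N p * gaussCurv r N p * partialK F (curvatures r N p)
    - 2 * meanCurv r N p * F (curvatures r N p)

/-- The area density `√det(g_ij)`, `g_ij = ⟪∂_i X, ∂_j X⟫`, of a parametrization `X`. -/
def areaDensity (X : Plane → Space) (x : Plane) : ℝ :=
  Real.sqrt (Matrix.det (Matrix.of fun i j : Fin 2 =>
    ⟪fderiv ℝ X x (EuclideanSpace.single i 1), fderiv ℝ X x (EuclideanSpace.single j 1)⟫_ℝ))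

/-- The area measure `√det(g_ij) dx¹ dx²` on the domain of the chart of `M` at `c`. -/
def chartArea [MeasurableSpace M] (r : M → Space) (c : M) : Measure M :=
  Measure.map (chartAt Plane c).symm
    ((volume.restrict (chartAt Plane c).target).withDensity fun x =>
      ENNReal.ofReal (areaDensity (r ∘ (chartAt Plane c).symm) x))

/-- The area measure `dV` of the induced metric: the chart measures agree on overlaps, and `dV` is
the least measure that dominates all of them, so that it coincides with each on its chart domain. -/
def area [MeasurableSpace M] (r : M → Space) : Measure M :=
  ⨆ c : M, chartArea r c

/-- The functional `∫_C F(H, K) dV`. -/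
def functional [MeasurableSpace M] (F : ℝ × ℝ → ℝ) (r N : M → Space) (C : Set M) : ℝ :=
  ∫ p in C, F (curvatures r N p) ∂(area r)

/-- The normal variation `r_t = r + t u N`. -/
def normalVariation (r N : M → Space) (u : M → ℝ) (t : ℝ) (p : M) : Space :=
  r p + (t * u p) • N p

/-- The unit normal of the immersion `r'` on the side of the reference field `N`: the normalized
projection of `N p` to the normal line of `r'` at `p`. -/
def unitNormalNear (r' N : M → Space) (p : M) : Space :=
  ‖(tangentPlane r' p)ᗮ.starProjection (N p)‖⁻¹ • (tangentPlane r' p)ᗮ.starProjection (N p)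

/-- The value of `∫_C F(H, K) dV` on the varied surface `r_t = r + t u N`, with its unit normal that
continues `N`. -/
def variedFunctional [MeasurableSpace M] (F : ℝ × ℝ → ℝ) (r N : M → Space) (u : M → ℝ) (C : Set M)
    (t : ℝ) : ℝ :=
  functional F (normalVariation r N u t) (unitNormalNear (normalVariation r N u t) N) C

/-- An admissible variation: a smooth function `u` and a compact set `C` that contains its support
(`C` is where the functional is evaluated: its integral over all of `M` need not exist; for compact
`M` one may take `C = M`). -/
def IsAdmissible (u : M → ℝ) (C : Set M) : Prop :=
  ContMDiff (𝓡 2) 𝓘(ℝ, ℝ) ∞ u ∧ IsCompact C ∧ tsupport u ⊆ C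

/-- `r` is critical for `∫ F(H, K) dV` under compactly supported variations. -/
def IsCritical [MeasurableSpace M] (F : ℝ × ℝ → ℝ) (r N : M → Space) : Prop :=
  ∀ (u : M → ℝ) (C : Set M), IsAdmissible u C →
    HasDerivAt (variedFunctional F r N u C) 0 0

end

end ImmersedSurface

end

set_option linter.unusedSectionVars false

noncomputable section

namespace ImmersedSurface

open scoped Topology
open ContinuousLinearMap (adjoint)

/-! ### Linear algebra of an injective map from the plane to space -/

/-! The first variation is computed pointwise in a chart and then integrated by parts. Let `X` and
`n` be the chart expressions of `r` and `N`, and `G_t = d(X + t u n)`. Differentiating `⟪n_t, G_t v⟫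
= 0` and `|n_t| = 1` at `t = 0` gives `n' = -∇u`. Differentiating `⟪G_t A_t w, G_t v⟫ = ⟪D²X_t(w,
v), n_t⟫` then gives `A' = Hess u + u A²`, and the area element changes at the rate `-2 H u`. By
Cayley-Hamilton in dimension two, `H' = ½ Δu + (2H² - K) u` and `K' = 2H Δu - tr(A Hess u) + 2HK u`,
so the derivative of the integrand is `firstVariation` (`IsPatch.hasDerivAt_varShape`,
`IsPatch.hasDerivAt_varDensity`, `hasDerivAt_variedIntegrand`).

This expression contains second derivatives of `u`. With `ψ = ½ F_H + 2 H F_K` and `B = F_K h`, it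
differs from `u E` by the divergence of `ψ ∇u - u ∇ψ - B ∇u - u ∇*B`. That is a compactly supported
tangent field, so its divergence integrates to zero (`integral_divg_eq_zero`,
`integral_firstVariation`).

The rest is analysis. The area of `r_t` has a density with respect to the area of `r`
(`area_eq_withDensity`), so only the integrand depends on `t`. It is `C¹` jointly in `t` and the
coordinates near `t = 0`, and compactness of `C` turns this into a uniform bound that permits
differentiation under the integral (`hasDerivAt_setIntegral_of_contDiffAt_chart`). Finally `E` is
continuous and nonempty open sets have positive area, so the fundamental lemma of the calculus of
variations turns criticality into `E = 0` at every point. -/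

/-- The adjoint as a real linear continuous map. -/
def adjointCLM : (Plane →L[ℝ] Space) →L[ℝ] (Space →L[ℝ] Plane) :=
  LinearMap.toContinuousLinearMap
    { toFun := fun G => adjoint G
      map_add' := fun G G' => map_add _ G G'
      map_smul' := fun a G => by simp }

@[simp] lemma adjointCLM_apply (G : Plane →L[ℝ] Space) : adjointCLM G = adjoint G := rfl

/-- The Gram operator `G† G`. -/
def gram (G : Plane →L[ℝ] Space) : Plane →L[ℝ] Plane := adjoint G ∘L G

lemma inner_gram (G : Plane →L[ℝ] Space) (v w : Plane) :
    ⟪gram G v, w⟫_ℝ = ⟪G v, G w⟫_ℝ := by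
  simp [gram, ContinuousLinearMap.adjoint_inner_left]

/-- The left inverse `(G† G)⁻¹ G†`. -/
def leftInv (G : Plane →L[ℝ] Space) : Space →L[ℝ] Plane := (gram G).inverse ∘L adjoint G

lemma isInvertible_of_injective {A : Plane →L[ℝ] Plane} (hA : Function.Injective A) :
    A.IsInvertible :=
  ⟨(LinearEquiv.ofInjectiveEndo A.toLinearMap hA).toContinuousLinearEquiv, by ext; rfl⟩

lemma gram_isInvertible {G : Plane →L[ℝ] Space} (hG : Function.Injective G) :
    (gram G).IsInvertible := by
  refine isInvertible_of_injective ((injective_iff_map_eq_zero _).2 fun v hv => ?_)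
  have h := inner_gram G v v
  rw [hv, inner_zero_left, eq_comm, inner_self_eq_zero] at h
  exact hG (by simpa using h)

lemma leftInv_comp_self {G : Plane →L[ℝ] Space} (hG : Function.Injective G) :
    leftInv G ∘L G = .id ℝ _ :=
  (gram_isInvertible hG).inverse_comp_self

lemma leftInv_apply_self {G : Plane →L[ℝ] Space} (hG : Function.Injective G) (v : Plane) :
    leftInv G (G v) = v :=
  DFunLike.congr_fun (leftInv_comp_self hG) v

lemma gram_leftInv {G : Plane →L[ℝ] Space} (hG : Function.Injective G) :
    gram G ∘L leftInv G = adjoint G := by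
  ext1 v
  exact (gram_isInvertible hG).self_apply_inverse _

lemma det_gram_nonneg (G : Plane →L[ℝ] Space) : 0 ≤ (gram G).det := by
  have h : (gram G).toLinearMap.IsPositive := by
    have := ContinuousLinearMap.isPositive_adjoint_comp_self G
    exact (ContinuousLinearMap.isPositive_toLinearMap_iff _).2 this
  have h2 := (LinearMap.posSemidef_toMatrix_iff (stdOrthonormalBasis ℝ Plane)).2 h
  have := h2.det_nonneg
  rwa [LinearMap.det_toMatrix] at this

lemma det_ne_zero_of_isInvertible {A : Plane →L[ℝ] Plane} (hA : A.IsInvertible) : A.det ≠ 0 := by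
  obtain ⟨e, rfl⟩ := hA
  exact e.toLinearEquiv.isUnit_det'.ne_zero

lemma isInvertible_of_det_ne_zero {A : Plane →L[ℝ] Plane} (hA : A.det ≠ 0) : A.IsInvertible :=
  isInvertible_of_injective (LinearMap.equivOfDetNeZero A.toLinearMap hA).injective

lemma det_gram_pos {G : Plane →L[ℝ] Space} (hG : Function.Injective G) : 0 < (gram G).det :=
  lt_of_le_of_ne (det_gram_nonneg G) (det_ne_zero_of_isInvertible (gram_isInvertible hG)).symm

/-- A nonzero Gram determinant is an open condition, so this is how injectivity of `dX` passes to
nearby parameters and points. -/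
lemma injective_of_det_gram_ne_zero {G : Plane →L[ℝ] Space} (hG : (gram G).det ≠ 0) :
    Function.Injective G := by
  have := (isInvertible_of_det_ne_zero hG).injective
  exact Function.Injective.of_comp (f := adjoint G) this

lemma contDiff_gram {n : ℕ∞ω} : ContDiff ℝ n gram :=
  adjointCLM.contDiff.clm_comp contDiff_id

lemma contDiff_clm_det {n : ℕ∞ω} :
    ContDiff ℝ n (fun A : Plane →L[ℝ] Plane => A.det) := by
  have h : (fun A : Plane →L[ℝ] Plane => A.det) = fun A =>
      (A (EuclideanSpace.single 0 1)) 0 * (A (EuclideanSpace.single 1 1)) 1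
        - (A (EuclideanSpace.single 1 1)) 0 * (A (EuclideanSpace.single 0 1)) 1 := by
    ext A
    have := LinearMap.det_toMatrix (EuclideanSpace.basisFun (Fin 2) ℝ).toBasis A.toLinearMap
    rw [ContinuousLinearMap.det, ← this, Matrix.det_fin_two]
    simp [LinearMap.toMatrix_apply]
  rw [h]
  fun_prop

lemma contDiffAt_inverse_gram {n : ℕ∞ω} {G : Plane →L[ℝ] Space} (hG : Function.Injective G) :
    ContDiffAt ℝ n (fun G => (gram G).inverse) G :=
  ((gram_isInvertible hG).contDiffAt_map_inverse).comp G contDiff_gram.contDiffAt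

lemma contDiffAt_leftInv {n : ℕ∞ω} {G : Plane →L[ℝ] Space} (hG : Function.Injective G) :
    ContDiffAt ℝ n leftInv G :=
  (contDiffAt_inverse_gram hG).clm_comp adjointCLM.contDiff.contDiffAt

/-- Orthogonal projection onto the range of `G`. -/
lemma starProjection_range {G : Plane →L[ℝ] Space} (hG : Function.Injective G) :
    (LinearMap.range G.toLinearMap).starProjection = G ∘L leftInv G := by
  ext1 v
  apply Submodule.eq_starProjection_of_mem_of_inner_eq_zero
  · exact ⟨leftInv G v, rfl⟩
  · rintro _ ⟨w, rfl⟩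
    have : ⟪G (leftInv G v), G w⟫_ℝ = ⟪v, G w⟫_ℝ := by
      rw [← inner_gram, ← ContinuousLinearMap.comp_apply, gram_leftInv hG,
        ContinuousLinearMap.adjoint_inner_left]
    simp [inner_sub_left, this]

/-- If `n` is a unit normal of the range of `G`, then `G G⁺ = 1 - n ⊗ n`. -/
lemma comp_leftInv_apply {G : Plane →L[ℝ] Space} (hG : Function.Injective G) {n : Space}
    (hn : ‖n‖ = 1) (hnG : ∀ v, ⟪n, G v⟫_ℝ = 0) (v : Space) :
    G (leftInv G v) = v - ⟪n, v⟫_ℝ • n := by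
  have hR : LinearMap.range G.toLinearMap = (ℝ ∙ n)ᗮ := by
    have hle : LinearMap.range G.toLinearMap ≤ (ℝ ∙ n)ᗮ := by
      rintro _ ⟨w, rfl⟩
      exact Submodule.mem_orthogonal_singleton_iff_inner_right.2 (hnG w)
    -- Both subspaces are two-dimensional, so the inclusion is an equality.
    refine Submodule.eq_of_le_of_finrank_eq hle ?_
    rw [LinearMap.finrank_range_of_inj hG]
    have hn0 : n ≠ 0 := by rintro rfl; simp at hn
    have : Fact (Module.finrank ℝ Space = 2 + 1) := ⟨by simp⟩
    rw [Submodule.finrank_orthogonal_span_singleton (𝕜 := ℝ) (n := 2) hn0]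
    simp
  have := DFunLike.congr_fun (starProjection_range hG) v
  rw [ContinuousLinearMap.comp_apply] at this
  rw [← this]
  -- The projection depends on an instance attached to the subspace, so the equality of subspaces is
  -- transported by substitution instead of by rewriting.
  have h2 : ∀ (U U' : Submodule ℝ Space), U = U' → U.starProjection = U'.starProjection := by
    rintro U _ rfl; rfl
  rw [h2 _ _ hR, Submodule.starProjection_orthogonal]
  simp [Submodule.starProjection_unit_singleton ℝ hn]

lemma leftInv_normal {G : Plane →L[ℝ] Space} {n : Space}
    (hnG : ∀ v, ⟪n, G v⟫_ℝ = 0) : leftInv G n = 0 := by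
  have : adjoint G n = 0 := by
    refine ext_inner_right ℝ fun v => ?_
    rw [ContinuousLinearMap.adjoint_inner_left, hnG, inner_zero_left]
  simp [leftInv, this]

lemma gram_comp (G : Plane →L[ℝ] Space) (T : Plane →L[ℝ] Plane) :
    gram (G ∘L T) = adjoint T ∘L gram G ∘L T := by
  simp [gram, ContinuousLinearMap.adjoint_comp, ContinuousLinearMap.comp_assoc]

lemma det_adjoint (T : Plane →L[ℝ] Plane) : (adjoint T).det = T.det := by
  rw [ContinuousLinearMap.det, ContinuousLinearMap.det,
    ← LinearMap.det_toMatrix (EuclideanSpace.basisFun (Fin 2) ℝ).toBasis,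
    ← LinearMap.det_toMatrix (EuclideanSpace.basisFun (Fin 2) ℝ).toBasis]
  have : (adjoint T : Plane →ₗ[ℝ] Plane) = LinearMap.adjoint (T : Plane →ₗ[ℝ] Plane) := by
    simp [LinearMap.adjoint_eq_toCLM_adjoint]
    rfl
  rw [this, LinearMap.toMatrix_adjoint]
  simp

lemma det_clm_comp (A B : Plane →L[ℝ] Plane) : (A ∘L B).det = A.det * B.det := by
  simp [ContinuousLinearMap.det]

/-- The factor `T.det ^ 2` becomes the Jacobian `|T.det|` in the area density and cancels in
quotients of area elements. -/
lemma det_gram_comp (G : Plane →L[ℝ] Space) (T : Plane →L[ℝ] Plane) :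
    (gram (G ∘L T)).det = T.det ^ 2 * (gram G).det := by
  rw [gram_comp, det_clm_comp, det_clm_comp, det_adjoint]; ring

/-- Change of coordinates in the left inverse. -/
lemma leftInv_comp {G : Plane →L[ℝ] Space} (T : Plane ≃L[ℝ] Plane) :
    leftInv (G ∘L T) = (T.symm : Plane →L[ℝ] Plane) ∘L leftInv G := by
  have hT : ((adjoint (T : Plane →L[ℝ] Plane))).IsInvertible := by
    apply isInvertible_of_det_ne_zero
    rw [det_adjoint]; exact det_ne_zero_of_isInvertible ⟨T, rfl⟩
  have hT1 : (T : Plane →L[ℝ] Plane).IsInvertible := ⟨T, rfl⟩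
  rw [leftInv, gram_comp, hT.inverse_comp_of_left, hT1.inverse_comp_of_right,
    ContinuousLinearMap.adjoint_comp]
  ext1 v
  simp [leftInv, hT.inverse_apply_self]

/-- The matrix `g_ij` is the matrix of `G† G` in the standard basis, so the density has a basis-free
form that can be differentiated as a function of `G`. -/
lemma areaDensity_eq (X : Plane → Space) (x : Plane) :
    areaDensity X x = Real.sqrt (gram (fderiv ℝ X x)).det := by
  rw [areaDensity, ContinuousLinearMap.det,
    ← LinearMap.det_toMatrix (EuclideanSpace.basisFun (Fin 2) ℝ).toBasis]
  congr 2
  ext i j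
  rw [LinearMap.toMatrix_apply]
  simp only [Matrix.of_apply, OrthonormalBasis.coe_toBasis, EuclideanSpace.basisFun_apply,
    OrthonormalBasis.coe_toBasis_repr_apply, EuclideanSpace.basisFun_repr]
  rw [real_inner_comm]
  have := inner_gram (fderiv ℝ X x) (EuclideanSpace.single j 1) (EuclideanSpace.single i 1)
  rw [← this, real_inner_comm]
  simp [EuclideanSpace.inner_single_left]

/-! ### Coordinates -/

lemma mem_nhds_chart_target {M : Type*} [TopologicalSpace M] [ChartedSpace Plane M] (c : M)
    {x : Plane} (hx : x ∈ (chartAt Plane c).target) : (chartAt Plane c).target ∈ 𝓝 x :=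
  (chartAt Plane c).open_target.mem_nhds hx

section Charts

variable {M : Type*} [TopologicalSpace M] [ChartedSpace Plane M] [IsManifold (𝓡 2) ∞ M]
variable {V : Type*} [NormedAddCommGroup V] [NormedSpace ℝ V]

lemma diff_plane (f : Plane → V) (x : Plane) : diff f x = fderiv ℝ f x := mfderiv_eq_fderiv

/-- The chart is centred at an arbitrary `c` whose domain contains the point, so one chart serves a
whole neighbourhood. -/
lemma contMDiffAt_iff_chart {n : ℕ∞ω} (hn : n ≤ ∞) (c : M) {x : Plane}
    (hx : x ∈ (chartAt Plane c).target) {f : M → V} :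
    ContMDiffAt (𝓡 2) 𝓘(ℝ, V) n f ((chartAt Plane c).symm x) ↔
      ContDiffAt ℝ n (f ∘ (chartAt Plane c).symm) x := by
  have : IsManifold (𝓡 2) n M := IsManifold.of_le hn
  rw [contMDiffAt_iff_source_of_mem_source (x := c) ((chartAt Plane c).map_target hx)]
  simp only [mfld_simps, hx]
  rw [contMDiffWithinAt_univ, contMDiffAt_iff_contDiffAt]

/-- The derivative of the inverse of the chart at `c`. -/
def chartDeriv (c : M) {x : Plane} (hx : x ∈ (chartAt Plane c).target) : Plane ≃L[ℝ] Plane :=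
  have : IsManifold (𝓡 2) 1 M := IsManifold.of_le (n := ∞) (by simp)
  ((mdifferentiable_chart (I := 𝓡 2) c).symm.mfderiv hx)

lemma fderiv_comp_chart (c : M) {x : Plane} (hx : x ∈ (chartAt Plane c).target) {f : M → V}
    (hf : MDifferentiableAt (𝓡 2) 𝓘(ℝ, V) f ((chartAt Plane c).symm x)) :
    fderiv ℝ (f ∘ (chartAt Plane c).symm) x =
      diff f ((chartAt Plane c).symm x) ∘L (chartDeriv c hx : Plane →L[ℝ] Plane) := by
  have : IsManifold (𝓡 2) 1 M := IsManifold.of_le (n := ∞) (by simp)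
  rw [← mfderiv_eq_fderiv]
  exact mfderiv_comp x hf ((mdifferentiable_chart (I := 𝓡 2) c).mdifferentiableAt_symm hx)

/-- Both differentials acquire the derivative of the inverse chart on the right; `leftInv_comp`
inverts it, and the two factors cancel. -/
lemma tderiv_chart (c : M) {x : Plane} (hx : x ∈ (chartAt Plane c).target) {r : M → Space}
    {f : M → V} (hr : MDifferentiableAt (𝓡 2) 𝓘(ℝ, Space) r ((chartAt Plane c).symm x))
    (hf : MDifferentiableAt (𝓡 2) 𝓘(ℝ, V) f ((chartAt Plane c).symm x)) :
    tderiv r f ((chartAt Plane c).symm x) =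
      fderiv ℝ (f ∘ (chartAt Plane c).symm) x ∘L
        leftInv (fderiv ℝ (r ∘ (chartAt Plane c).symm) x) := by
  rw [fderiv_comp_chart c hx hr, fderiv_comp_chart c hx hf, leftInv_comp]
  ext1 v
  simp only [ContinuousLinearMap.comp_apply, ContinuousLinearEquiv.coe_coe,
    ContinuousLinearEquiv.apply_symm_apply]
  rfl

/-- A change of coordinates conjugates the Weingarten operator, which is why its trace and
determinant may be computed in any chart. -/
lemma weingarten_chart (c : M) {x : Plane} (hx : x ∈ (chartAt Plane c).target) {r N : M → Space}
    (hr : MDifferentiableAt (𝓡 2) 𝓘(ℝ, Space) r ((chartAt Plane c).symm x))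
    (hN : MDifferentiableAt (𝓡 2) 𝓘(ℝ, Space) N ((chartAt Plane c).symm x)) :
    weingarten (r ∘ (chartAt Plane c).symm) (N ∘ (chartAt Plane c).symm) x =
      ((chartDeriv c hx).symm : Plane →L[ℝ] Plane) ∘L
        weingarten r N ((chartAt Plane c).symm x) ∘L (chartDeriv c hx : Plane →L[ℝ] Plane) := by
  have h : ∀ (r N : Plane → Space) x, weingarten r N x = -(leftInv (diff r x) ∘L diff N x) :=
    fun _ _ _ => rfl
  rw [h, diff_plane, diff_plane, fderiv_comp_chart c hx hr, fderiv_comp_chart c hx hN,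
    leftInv_comp]
  ext1 v
  simp [weingarten]
  rfl

lemma meanCurv_chart (c : M) {x : Plane} (hx : x ∈ (chartAt Plane c).target) {r N : M → Space}
    (hr : MDifferentiableAt (𝓡 2) 𝓘(ℝ, Space) r ((chartAt Plane c).symm x))
    (hN : MDifferentiableAt (𝓡 2) 𝓘(ℝ, Space) N ((chartAt Plane c).symm x)) :
    meanCurv r N ((chartAt Plane c).symm x) =
      meanCurv (r ∘ (chartAt Plane c).symm) (N ∘ (chartAt Plane c).symm) x := by
  rw [meanCurv, meanCurv, weingarten_chart c hx hr hN]
  congr 1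
  exact (LinearMap.trace_conj' (weingarten r N ((chartAt Plane c).symm x)).toLinearMap
    (chartDeriv c hx).symm.toLinearEquiv).symm

lemma gaussCurv_chart (c : M) {x : Plane} (hx : x ∈ (chartAt Plane c).target) {r N : M → Space}
    (hr : MDifferentiableAt (𝓡 2) 𝓘(ℝ, Space) r ((chartAt Plane c).symm x))
    (hN : MDifferentiableAt (𝓡 2) 𝓘(ℝ, Space) N ((chartAt Plane c).symm x)) :
    gaussCurv r N ((chartAt Plane c).symm x) =
      gaussCurv (r ∘ (chartAt Plane c).symm) (N ∘ (chartAt Plane c).symm) x := by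
  rw [gaussCurv, gaussCurv, weingarten_chart c hx hr hN]
  exact (LinearMap.det_conj (weingarten r N ((chartAt Plane c).symm x)).toLinearMap
    (chartDeriv c hx).symm.toLinearEquiv).symm

lemma tangentPlane_chart (c : M) {x : Plane} (hx : x ∈ (chartAt Plane c).target) {r : M → Space}
    (hr : MDifferentiableAt (𝓡 2) 𝓘(ℝ, Space) r ((chartAt Plane c).symm x)) :
    tangentPlane (r ∘ (chartAt Plane c).symm) x = tangentPlane r ((chartAt Plane c).symm x) := by
  rw [tangentPlane, diff_plane, fderiv_comp_chart c hx hr]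
  exact LinearMap.range_comp_of_range_eq_top _
    (LinearMap.range_eq_top.2 (chartDeriv c hx).surjective)

lemma unitNormalNear_chart (c : M) {x : Plane} (hx : x ∈ (chartAt Plane c).target)
    {r : M → Space} (N : M → Space)
    (hr : MDifferentiableAt (𝓡 2) 𝓘(ℝ, Space) r ((chartAt Plane c).symm x)) :
    unitNormalNear (r ∘ (chartAt Plane c).symm) (N ∘ (chartAt Plane c).symm) x =
      unitNormalNear r N ((chartAt Plane c).symm x) := by
  have h2 : ∀ (U U' : Submodule ℝ Space), U = U' → Uᗮ.starProjection = U'ᗮ.starProjection := by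
    rintro U _ rfl; rfl
  rw [unitNormalNear, unitNormalNear, h2 _ _ (tangentPlane_chart c hx hr)]
  rfl

lemma injective_fderiv_chart {r : M → Space} (hr : IsSmoothImmersion r) (c : M) {x : Plane}
    (hx : x ∈ (chartAt Plane c).target) :
    Function.Injective (fderiv ℝ (r ∘ (chartAt Plane c).symm) x) := by
  rw [fderiv_comp_chart c hx ((hr.1 _).mdifferentiableAt (by simp))]
  exact (hr.2 _).comp (chartDeriv c hx).injective

lemma contDiffAt_comp_chart {f : M → V} (hf : ContMDiff (𝓡 2) 𝓘(ℝ, V) ∞ f) (c : M)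
    {x : Plane} (hx : x ∈ (chartAt Plane c).target) :
    ContDiffAt ℝ ∞ (f ∘ (chartAt Plane c).symm) x :=
  (contMDiffAt_iff_chart le_rfl c hx).1 (hf _)

/-- Regularity may be checked in the charts. -/
lemma contMDiff_of_chart {n : ℕ∞ω} (hn : n ≤ ∞) {f : M → V}
    (h : ∀ (c : M), ∀ x ∈ (chartAt Plane c).target,
      ContDiffAt ℝ n (f ∘ (chartAt Plane c).symm) x) : ContMDiff (𝓡 2) 𝓘(ℝ, V) n f := by
  intro c
  have := (contMDiffAt_iff_chart hn c (mem_chart_target Plane c)).2 (h c _ (mem_chart_target _ c))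
  rwa [(chartAt Plane c).left_inv (mem_chart_source _ c)] at this

/-- In a chart this is `df` followed on the right by the left inverse of `dX`. The first factor
costs one derivative and the second is smooth. -/
lemma contMDiff_tderiv {r : M → Space} (hr : IsSmoothImmersion r) {m n : ℕ∞ω} (hn : n ≤ ∞)
    (hmn : m + 1 ≤ n) {f : M → V} (hf : ContMDiff (𝓡 2) 𝓘(ℝ, V) n f) :
    ContMDiff (𝓡 2) 𝓘(ℝ, Space →L[ℝ] V) m (tderiv r f) := by
  have hm : m ≤ ∞ := (le_self_add.trans hmn).trans hn
  have h1n : 1 ≤ n := le_add_self.trans hmn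
  refine contMDiff_of_chart hm fun c x hx => ?_
  have h1 : ContDiffAt ℝ m (fderiv ℝ (f ∘ (chartAt Plane c).symm)) x :=
    ((contMDiffAt_iff_chart hn c hx).1 (hf _)).fderiv_right hmn
  have h2 : ContDiffAt ℝ m (fderiv ℝ (r ∘ (chartAt Plane c).symm)) x :=
    ((contDiffAt_comp_chart hr.1 c hx).fderiv_right (m := ∞) le_rfl).of_le hm
  have h3 : ContDiffAt ℝ m (fun y => leftInv (fderiv ℝ (r ∘ (chartAt Plane c).symm) y)) x :=
    (contDiffAt_leftInv (injective_fderiv_chart hr c hx)).comp x h2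
  refine (h1.clm_comp h3).congr_of_eventuallyEq ?_
  filter_upwards [mem_nhds_chart_target c hx] with y hy
  exact tderiv_chart c hy ((hr.1 _).mdifferentiableAt (by simp))
    ((hf _).mdifferentiableAt (by rintro rfl; simp at h1n))

end Charts

/-! ### The area measure -/

lemma areaDensity_nonneg (X : Plane → Space) (x : Plane) : 0 ≤ areaDensity X x :=
  Real.sqrt_nonneg _

section AreaRatio

variable {M : Type*} [TopologicalSpace M] [ChartedSpace Plane M] [IsManifold (𝓡 2) ∞ M]

/-- The ratio of the area elements of two maps. -/
def areaRatio (r r' : M → Space) (p : M) : ℝ :=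
  √((gram (diff r' p)).det / (gram (diff r p)).det)

lemma areaRatio_nonneg (r r' : M → Space) (p : M) : 0 ≤ areaRatio r r' p :=
  Real.sqrt_nonneg _

lemma areaRatio_chart {r r' : M → Space} (c : M) {x : Plane}
    (hx : x ∈ (chartAt Plane c).target)
    (hr : MDifferentiableAt (𝓡 2) 𝓘(ℝ, Space) r ((chartAt Plane c).symm x))
    (hr' : MDifferentiableAt (𝓡 2) 𝓘(ℝ, Space) r' ((chartAt Plane c).symm x)) :
    areaRatio r r' ((chartAt Plane c).symm x) =
      √((gram (fderiv ℝ (r' ∘ (chartAt Plane c).symm) x)).det /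
        (gram (fderiv ℝ (r ∘ (chartAt Plane c).symm) x)).det) := by
  have hT : (chartDeriv c hx : Plane →L[ℝ] Plane).det ≠ 0 := det_ne_zero_of_isInvertible ⟨_, rfl⟩
  rw [fderiv_comp_chart c hx hr, fderiv_comp_chart c hx hr', det_gram_comp, det_gram_comp,
    mul_div_mul_left _ _ (pow_ne_zero 2 hT), areaRatio]

/-- Only the denominator must not vanish, and `√` is continuous at zero too. So `r'` may fail to be
an immersion, as `r_t` may for large `t`. -/
lemma continuous_areaRatio {r r' : M → Space} (hr : IsSmoothImmersion r)
    (hr' : ContMDiff (𝓡 2) 𝓘(ℝ, Space) ∞ r') : Continuous (areaRatio r r') := by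
  rw [← contMDiff_zero_iff (I := 𝓡 2) (I' := 𝓘(ℝ, ℝ))]
  refine contMDiff_of_chart (by simp) fun c x hx => contDiffAt_zero.2 ?_
  refine ⟨_, mem_nhds_chart_target c hx, fun y hy => ContinuousAt.continuousWithinAt ?_⟩
  have hcont : ∀ {f : M → Space}, ContMDiff (𝓡 2) 𝓘(ℝ, Space) ∞ f →
      ContinuousAt (fun y => (gram (fderiv ℝ (f ∘ (chartAt Plane c).symm) y)).det) y := fun hf =>
    ((contDiff_clm_det (n := 0)).continuous.comp (contDiff_gram (n := 0)).continuous).continuousAt.comp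
      ((contDiffAt_comp_chart hf c hy).fderiv_right (m := 0) (by simp)).continuousAt
  have h := ((hcont hr').div (hcont hr.1) (det_gram_pos (injective_fderiv_chart hr c hy)).ne').sqrt
  refine h.congr ?_
  filter_upwards [mem_nhds_chart_target c hy] with z hz
  exact (areaRatio_chart c hz ((hr.1 _).mdifferentiableAt (by simp))
    ((hr' _).mdifferentiableAt (by simp))).symm

lemma continuousOn_areaDensity {r : M → Space} (hr : ContMDiff (𝓡 2) 𝓘(ℝ, Space) ∞ r) (c : M) :
    ContinuousOn (areaDensity (r ∘ (chartAt Plane c).symm)) (chartAt Plane c).target := by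
  intro x hx
  have h2 : ContinuousAt (fderiv ℝ (r ∘ (chartAt Plane c).symm)) x :=
    ((contDiffAt_comp_chart hr c hx).fderiv_right (m := 0) (by simp)).continuousAt
  have h3 : areaDensity (r ∘ (chartAt Plane c).symm) = fun x =>
      √(gram (fderiv ℝ (r ∘ (chartAt Plane c).symm) x)).det := funext fun x => areaDensity_eq _ x
  rw [h3]
  exact (Real.continuous_sqrt.continuousAt.comp ((contDiff_clm_det (n := 0)).continuous.comp
    (contDiff_gram (n := 0)).continuous).continuousAt |>.comp h2).continuousWithinAt

lemma areaDensity_pos {r : M → Space} (hr : IsSmoothImmersion r) (c : M) {x : Plane}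
    (hx : x ∈ (chartAt Plane c).target) : 0 < areaDensity (r ∘ (chartAt Plane c).symm) x := by
  rw [areaDensity_eq]
  exact Real.sqrt_pos.2 (det_gram_pos (injective_fderiv_chart hr c hx))

end AreaRatio

section Area

variable {M : Type*} [TopologicalSpace M] [ChartedSpace Plane M] [IsManifold (𝓡 2) ∞ M]
  [MeasurableSpace M] [BorelSpace M]

lemma measurableSet_chart_source (c : M) : MeasurableSet (chartAt Plane c).source :=
  (chartAt Plane c).open_source.measurableSet

lemma measurableSet_chart_target (c : M) : MeasurableSet (chartAt Plane c).target :=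
  (chartAt Plane c).open_target.measurableSet

lemma aemeasurable_chart_symm (c : M) :
    AEMeasurable (chartAt Plane c).symm (volume.restrict (chartAt Plane c).target) :=
  (chartAt Plane c).continuousOn_symm.aemeasurable (measurableSet_chart_target c)

/-- The inverse chart is continuous only on the target, so the preimage is measurable in that
subtype first and is then pushed into the plane. -/
lemma measurableSet_chart_preimage (c : M) {s : Set M} (hs : MeasurableSet s) :
    MeasurableSet ((chartAt Plane c).target ∩ (chartAt Plane c).symm ⁻¹' s) := by
  have := (chartAt Plane c).continuousOn_symm.domRestrict.measurable hs
  have h2 := (MeasurableEmbedding.subtype_coe (measurableSet_chart_target c)).measurableSet_image.2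
    this
  convert h2 using 1
  ext x
  simp [and_comm]

lemma chartArea_apply (r : M → Space) (c : M) {s : Set M} (hs : MeasurableSet s) :
    chartArea r c s = ∫⁻ x in (chartAt Plane c).target ∩ (chartAt Plane c).symm ⁻¹' s,
      ENNReal.ofReal (areaDensity (r ∘ (chartAt Plane c).symm) x) := by
  have h1 : AEMeasurable (chartAt Plane c).symm
      ((volume.restrict (chartAt Plane c).target).withDensity fun x =>
        ENNReal.ofReal (areaDensity (r ∘ (chartAt Plane c).symm) x)) :=
    (aemeasurable_chart_symm c).mono_ac (withDensity_absolutelyContinuous _ _)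
  have h2 : NullMeasurableSet ((chartAt Plane c).symm ⁻¹' s)
      (volume.restrict (chartAt Plane c).target) :=
    (aemeasurable_chart_symm c).nullMeasurableSet_preimage hs
  rw [chartArea, Measure.map_apply_of_aemeasurable h1 hs, withDensity_apply₀ _ h2,
    Measure.restrict_restrict₀ h2, Set.inter_comm]

lemma chartArea_compl_source (r : M → Space) (c : M) :
    chartArea r c (chartAt Plane c).sourceᶜ = 0 := by
  rw [chartArea_apply r c (measurableSet_chart_source c).compl]
  have : (chartAt Plane c).target ∩ (chartAt Plane c).symm ⁻¹' (chartAt Plane c).sourceᶜ = ∅ := by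
    ext x
    simp only [Set.mem_inter_iff, Set.mem_preimage, Set.mem_compl_iff, Set.mem_empty_iff_false,
      iff_false, not_and, not_not]
    exact fun hx => (chartAt Plane c).map_target hx
  rw [this]; simp

/-- The chart measures agree on overlaps. -/
lemma chartArea_apply_eq {r : M → Space} (hr : MDifferentiable (𝓡 2) 𝓘(ℝ, Space) r) (c c' : M)
    {s : Set M} (hs : MeasurableSet s) (hsc : s ⊆ (chartAt Plane c).source)
    (hsc' : s ⊆ (chartAt Plane c').source) : chartArea r c s = chartArea r c' s := by
  set e := chartAt Plane c with he
  set e' := chartAt Plane c' with he'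
  set A := e.target ∩ e.symm ⁻¹' s with hA
  set A' := e'.target ∩ e'.symm ⁻¹' s with hA'
  have himg : (e' ∘ e.symm) '' A = A' := by
    ext y
    constructor
    · rintro ⟨x, ⟨hx, hxs⟩, rfl⟩
      refine ⟨e'.map_source (hsc' hxs), ?_⟩
      simpa [e'.left_inv (hsc' hxs)] using hxs
    · rintro ⟨hy, hys⟩
      refine ⟨e (e'.symm y), ⟨e.map_source (hsc hys), ?_⟩, ?_⟩
      · simpa [e.left_inv (hsc hys)] using hys
      · simp [e.left_inv (hsc hys), e'.right_inv hy]
  have hinj : Set.InjOn (e' ∘ e.symm) A := by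
    rintro x ⟨hx, hxs⟩ y ⟨hy, hys⟩ hxy
    exact e.symm.injOn hx hy (e'.injOn (hsc' hxs) (hsc' hys) hxy)
  have hdiff : ∀ x ∈ A, DifferentiableAt ℝ (e' ∘ e.symm) x := by
    rintro x ⟨hx, hxs⟩
    have h1 : IsManifold (𝓡 2) 1 M := IsManifold.of_le (n := ∞) (by simp)
    have h2 := (mdifferentiable_chart (I := 𝓡 2) c').mdifferentiableAt (hsc' hxs)
    have h3 := (mdifferentiable_chart (I := 𝓡 2) c).mdifferentiableAt_symm hx
    exact mdifferentiableAt_iff_differentiableAt.1 (h2.comp x h3)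
  -- By the chain rule the two parametrizations differ by the transition map; the square root of its
  -- squared determinant is exactly the Jacobian of the change of variables formula.
  have hden : ∀ x ∈ A, areaDensity (r ∘ e.symm) x =
      |(fderiv ℝ (e' ∘ e.symm) x).det| * areaDensity (r ∘ e'.symm) ((e' ∘ e.symm) x) := by
    rintro x ⟨hx, hxs⟩
    have hd' : DifferentiableAt ℝ (r ∘ e'.symm) ((e' ∘ e.symm) x) := by
      have h1 : IsManifold (𝓡 2) 1 M := IsManifold.of_le (n := ∞) (by simp)
      have h3 := (mdifferentiable_chart (I := 𝓡 2) c').mdifferentiableAt_symm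
        (e'.map_source (hsc' hxs))
      exact mdifferentiableAt_iff_differentiableAt.1 ((hr _).comp _ h3)
    have heq : r ∘ e.symm =ᶠ[𝓝 x] (r ∘ e'.symm) ∘ (e' ∘ e.symm) := by
      have : e.target ∩ e.symm ⁻¹' e'.source ∈ 𝓝 x :=
        (e.symm.isOpen_inter_preimage e'.open_source).mem_nhds ⟨hx, hsc' hxs⟩
      filter_upwards [this] with y hy
      simp [e'.left_inv hy.2]
    rw [areaDensity_eq, areaDensity_eq, heq.fderiv_eq, fderiv_comp x hd' (hdiff x ⟨hx, hxs⟩),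
      det_gram_comp, Real.sqrt_mul (sq_nonneg _), Real.sqrt_sq_eq_abs]
  rw [chartArea_apply r c hs, chartArea_apply r c' hs, ← hA', ← himg,
    lintegral_image_eq_lintegral_abs_det_fderiv_mul volume (measurableSet_chart_preimage c hs)
      (fun x hx => (hdiff x hx).hasFDerivAt.hasFDerivWithinAt) hinj]
  refine setLIntegral_congr_fun (measurableSet_chart_preimage c hs) fun x hx => ?_
  beta_reduce
  rw [← he', ← ENNReal.ofReal_mul (abs_nonneg _), ← hden x hx]

lemma chartArea_eq_restrict (r : M → Space) (c : M) :
    (chartArea r c).restrict (chartAt Plane c).source = chartArea r c :=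
  Measure.restrict_eq_self_of_ae_mem (chartArea_compl_source r c)

variable [SecondCountableTopology M]

/-- On a chart domain, the area is the chart measure. -/
lemma area_apply_of_subset {r : M → Space} (hr : MDifferentiable (𝓡 2) 𝓘(ℝ, Space) r) (c : M)
    {s : Set M} (hs : MeasurableSet s) (hsc : s ⊆ (chartAt Plane c).source) :
    area r s = chartArea r c s := by
  obtain ⟨S, hS, hSU⟩ := TopologicalSpace.countable_cover_nhds
    (fun c : M => (chartAt Plane c).open_source.mem_nhds (mem_chart_source Plane c))
  have hSne : S.Nonempty := by
    have : c ∈ ⋃ x ∈ S, (chartAt Plane x).source := hSU ▸ Set.mem_univ c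
    obtain ⟨x, hx, -⟩ := Set.mem_iUnion₂.1 this
    exact ⟨x, hx⟩
  obtain ⟨f, rfl⟩ := hS.exists_eq_range hSne
  rw [Set.biUnion_range] at hSU
  -- Cutting a countable atlas into disjoint pieces yields one measure `μ` that agrees with each
  -- chart measure on its chart domain. It dominates them all, hence also their supremum.
  set D : ℕ → Set M := disjointed fun n => (chartAt Plane (f n)).source with hD
  have hDm : ∀ n, MeasurableSet (D n) :=
    fun n => MeasurableSet.disjointed (fun n => measurableSet_chart_source (f n)) n
  have hDd : Pairwise (Function.onFun Disjoint D) := disjoint_disjointed _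
  have hDU : ⋃ n, D n = Set.univ := by rw [hD, iUnion_disjointed, hSU]
  have hDs : ∀ n, D n ⊆ (chartAt Plane (f n)).source := fun n => disjointed_subset _ n
  set μ : Measure M := Measure.sum fun n => (chartArea r (f n)).restrict (D n) with hμ
  have hμs : ∀ (c : M) (s : Set M), MeasurableSet s → s ⊆ (chartAt Plane c).source →
      μ s = chartArea r c s := by
    intro c s hs hsc
    have h1 : s = ⋃ n, s ∩ D n := by rw [← Set.inter_iUnion, hDU, Set.inter_univ]
    have h2 : chartArea r c s = ∑' n, chartArea r c (s ∩ D n) := by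
      conv_lhs => rw [h1]
      exact measure_iUnion
        (fun i j hij => (hDd hij).mono Set.inter_subset_right Set.inter_subset_right)
        fun n => hs.inter (hDm n)
    rw [h2, hμ, Measure.sum_apply _ hs]
    refine tsum_congr fun n => ?_
    rw [Measure.restrict_apply hs]
    exact chartArea_apply_eq hr _ _ (hs.inter (hDm n)) (Set.inter_subset_right.trans (hDs n))
      (Set.inter_subset_left.trans hsc)
  have hle : area r ≤ μ := by
    refine iSup_le fun c => Measure.le_iff.2 fun s hs => ?_
    rw [← chartArea_eq_restrict, Measure.restrict_apply hs,
      ← hμs c _ (hs.inter (measurableSet_chart_source c)) Set.inter_subset_right]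
    exact measure_mono Set.inter_subset_left
  refine le_antisymm ((hle s).trans (hμs c s hs hsc).le) ?_
  exact (le_iSup (fun c => chartArea r c) c : chartArea r c ≤ area r) s

lemma area_restrict_chart {r : M → Space} (hr : MDifferentiable (𝓡 2) 𝓘(ℝ, Space) r) (c : M) :
    (area r).restrict (chartAt Plane c).source = chartArea r c := by
  rw [← chartArea_eq_restrict]
  ext s hs
  rw [Measure.restrict_apply hs, Measure.restrict_apply hs]
  exact area_apply_of_subset hr c (hs.inter (measurableSet_chart_source c)) Set.inter_subset_right

/-- Measures that agree on every chart domain are equal. -/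
lemma measure_ext_chart {μ ν : Measure M}
    (h : ∀ (c : M) (s : Set M), MeasurableSet s → s ⊆ (chartAt Plane c).source → μ s = ν s) :
    μ = ν := by
  obtain ⟨S, hS, hSU⟩ := TopologicalSpace.countable_cover_nhds
    (fun c : M => (chartAt Plane c).open_source.mem_nhds (mem_chart_source Plane c))
  refine (Measure.ext_iff_of_biUnion_eq_univ hS hSU).2 fun c _ => ?_
  ext s hs
  rw [Measure.restrict_apply hs, Measure.restrict_apply hs]
  exact h c _ (hs.inter (measurableSet_chart_source c)) Set.inter_subset_right

lemma aemeasurable_areaDensity {r : M → Space} (hr : ContMDiff (𝓡 2) 𝓘(ℝ, Space) ∞ r) (c : M) :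
    AEMeasurable (fun x => ENNReal.ofReal (areaDensity (r ∘ (chartAt Plane c).symm) x))
      (volume.restrict (chartAt Plane c).target) :=
  ((continuousOn_areaDensity hr c).aemeasurable (measurableSet_chart_target c)).ennreal_ofReal

lemma setLIntegral_area_chart {r : M → Space} (hr : ContMDiff (𝓡 2) 𝓘(ℝ, Space) ∞ r) (c : M)
    {f : M → ENNReal} (hf : Measurable f) :
    ∫⁻ p in (chartAt Plane c).source, f p ∂(area r) =
      ∫⁻ x in (chartAt Plane c).target,
        ENNReal.ofReal (areaDensity (r ∘ (chartAt Plane c).symm) x) *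
          f ((chartAt Plane c).symm x) := by
  have h1 : AEMeasurable (chartAt Plane c).symm
      ((volume.restrict (chartAt Plane c).target).withDensity fun x =>
        ENNReal.ofReal (areaDensity (r ∘ (chartAt Plane c).symm) x)) :=
    (aemeasurable_chart_symm c).mono_ac (withDensity_absolutelyContinuous _ _)
  rw [area_restrict_chart (hr.mdifferentiable (by simp)), chartArea,
    lintegral_map' hf.aemeasurable h1]
  exact lintegral_withDensity_eq_lintegral_mul₀ (aemeasurable_areaDensity hr c)
    (hf.comp_aemeasurable (aemeasurable_chart_symm c))

lemma setIntegral_area_chart {r : M → Space} (hr : ContMDiff (𝓡 2) 𝓘(ℝ, Space) ∞ r) (c : M)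
    {f : M → ℝ} (hf : AEStronglyMeasurable f (area r)) :
    ∫ p in (chartAt Plane c).source, f p ∂(area r) =
      ∫ x in (chartAt Plane c).target,
        areaDensity (r ∘ (chartAt Plane c).symm) x * f ((chartAt Plane c).symm x) := by
  have h1 : AEMeasurable (chartAt Plane c).symm
      ((volume.restrict (chartAt Plane c).target).withDensity fun x =>
        ENNReal.ofReal (areaDensity (r ∘ (chartAt Plane c).symm) x)) :=
    (aemeasurable_chart_symm c).mono_ac (withDensity_absolutelyContinuous _ _)
  have h2 := hf.restrict (s := (chartAt Plane c).source)
  rw [area_restrict_chart (hr.mdifferentiable (by simp)), chartArea] at h2 ⊢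
  rw [integral_map h1 h2,
    integral_withDensity_eq_integral_toReal_smul₀ (aemeasurable_areaDensity hr c)
      (Filter.Eventually.of_forall fun _ => ENNReal.ofReal_lt_top)]
  refine integral_congr_ae (Filter.Eventually.of_forall fun x => ?_)
  simp only [smul_eq_mul]
  rw [ENNReal.toReal_ofReal (areaDensity_nonneg _ _)]

/-- The area is finite on compact sets. -/
lemma isLocallyFiniteMeasure_area {r : M → Space} (hr : ContMDiff (𝓡 2) 𝓘(ℝ, Space) ∞ r) :
    IsLocallyFiniteMeasure (area r) := by
  refine ⟨fun c => ?_⟩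
  set e := chartAt Plane c with he
  have hc := mem_chart_target Plane c
  have h1 : ∀ᶠ x in 𝓝 (e c), areaDensity (r ∘ e.symm) x < areaDensity (r ∘ e.symm) (e c) + 1 :=
    ((continuousOn_areaDensity hr c).continuousAt (mem_nhds_chart_target c hc)).eventually
      (gt_mem_nhds (lt_add_one _))
  obtain ⟨ε, hε, hball⟩ := Metric.eventually_nhds_iff_ball.1
    (h1.and (mem_nhds_chart_target c hc))
  have hopen := e.isOpen_inter_preimage (Metric.isOpen_ball (x := e c) (ε := ε))
  refine ⟨_, hopen.mem_nhds ⟨mem_chart_source _ c, Metric.mem_ball_self hε⟩, ?_⟩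
  rw [area_apply_of_subset (hr.mdifferentiable (by simp)) c hopen.measurableSet
    Set.inter_subset_left, chartArea_apply r c hopen.measurableSet]
  have hsub : e.target ∩ e.symm ⁻¹' (e.source ∩ e ⁻¹' Metric.ball (e c) ε) ⊆
      Metric.ball (e c) ε := by
    rintro x ⟨hx, -, hx2⟩
    simpa [e.right_inv hx] using hx2
  calc _ ≤ ∫⁻ x in Metric.ball (e c) ε,
        ENNReal.ofReal (areaDensity (r ∘ e.symm) (e c) + 1) :=
        (lintegral_mono_set hsub).trans (setLIntegral_mono measurable_const fun x hx =>
          ENNReal.ofReal_le_ofReal (hball x hx).1.le)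
    _ < ⊤ := by
      rw [setLIntegral_const]
      exact ENNReal.mul_lt_top ENNReal.ofReal_lt_top measure_ball_lt_top

/-- Nonempty open sets have positive area. -/
lemma isOpenPosMeasure_area {r : M → Space} (hr : IsSmoothImmersion r) :
    (area r).IsOpenPosMeasure := by
  refine ⟨fun U hU ⟨c, hc⟩ h0 => ?_⟩
  set e := chartAt Plane c with he
  have hV : IsOpen (U ∩ e.source) := hU.inter e.open_source
  have h1 : area r (U ∩ e.source) = 0 := measure_mono_null Set.inter_subset_left h0
  rw [area_apply_of_subset (hr.1.mdifferentiable (by simp)) c hV.measurableSet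
    Set.inter_subset_right, chartArea_apply r c hV.measurableSet] at h1
  have hA : IsOpen (e.target ∩ e.symm ⁻¹' (U ∩ e.source)) := e.isOpen_inter_preimage_symm hV
  rw [lintegral_eq_zero_iff' ((aemeasurable_areaDensity hr.1 c).mono_measure
    (Measure.restrict_mono Set.inter_subset_left le_rfl))] at h1
  have h2 : ∀ᵐ x ∂volume.restrict (e.target ∩ e.symm ⁻¹' (U ∩ e.source)), False := by
    filter_upwards [h1, ae_restrict_mem hA.measurableSet] with x hx hxA
    exact absurd (ENNReal.ofReal_eq_zero.1 hx) (areaDensity_pos hr c hxA.1).not_ge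
  rw [Filter.eventually_false_iff_eq_bot, ae_eq_bot, Measure.restrict_eq_zero] at h2
  refine (hA.measure_pos volume ⟨e c, e.map_source (mem_chart_source _ c), ?_⟩).ne' h2
  simp [e.left_inv (mem_chart_source _ c), hc, e]

/-- This moves the dependence on the variation from the measure to the integrand. It suffices to
compare both sides on chart domains, where the quotient of the area densities is `areaRatio`. -/
lemma area_eq_withDensity {r r' : M → Space} (hr : IsSmoothImmersion r)
    (hr' : ContMDiff (𝓡 2) 𝓘(ℝ, Space) ∞ r') :
    area r' = (area r).withDensity fun p => ENNReal.ofReal (areaRatio r r' p) := by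
  refine measure_ext_chart fun c s hs hsc => ?_
  have hm : Measurable fun p => ENNReal.ofReal (areaRatio r r' p) :=
    (continuous_areaRatio hr hr').measurable.ennreal_ofReal
  have key : ∫⁻ p in s, ENNReal.ofReal (areaRatio r r' p) ∂area r =
      ∫⁻ p in (chartAt Plane c).source,
        s.indicator (fun p => ENNReal.ofReal (areaRatio r r' p)) p ∂area r := by
    rw [setLIntegral_indicator hs, Set.inter_eq_left.2 hsc]
  rw [withDensity_apply _ hs, key, setLIntegral_area_chart hr.1 c (hm.indicator hs),
    area_apply_of_subset (hr'.mdifferentiable (by simp)) c hs hsc, chartArea_apply r' c hs]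
  have hA := measurableSet_chart_preimage c hs
  have : ∀ x ∈ (chartAt Plane c).target,
      ENNReal.ofReal (areaDensity (r ∘ (chartAt Plane c).symm) x) *
        s.indicator (fun p => ENNReal.ofReal (areaRatio r r' p)) ((chartAt Plane c).symm x) =
      ((chartAt Plane c).target ∩ (chartAt Plane c).symm ⁻¹' s).indicator
        (fun x => ENNReal.ofReal (areaDensity (r' ∘ (chartAt Plane c).symm) x)) x := by
    intro x hx
    by_cases hxs : (chartAt Plane c).symm x ∈ s
    · rw [Set.indicator_of_mem hxs, Set.indicator_of_mem (by exact ⟨hx, hxs⟩),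
        ← ENNReal.ofReal_mul (areaDensity_nonneg _ _),
        areaRatio_chart c hx ((hr.1 _).mdifferentiableAt (by simp))
          ((hr' _).mdifferentiableAt (by simp)), areaDensity_eq, areaDensity_eq,
        ← Real.sqrt_mul (det_gram_nonneg _),
        mul_div_cancel₀ _ (det_gram_pos (injective_fderiv_chart hr c hx)).ne']
    · rw [Set.indicator_of_notMem hxs, Set.indicator_of_notMem (fun h => hxs h.2), mul_zero]
  rw [setLIntegral_congr_fun (measurableSet_chart_target c) this, setLIntegral_indicator hA,
    Set.inter_eq_left.2 Set.inter_subset_left]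

end Area

/-! ### Tangential derivatives -/

section TangentialDerivative

variable {M : Type*} [TopologicalSpace M] [ChartedSpace Plane M]
variable {V V' V'' : Type*} [NormedAddCommGroup V] [NormedSpace ℝ V]
  [NormedAddCommGroup V'] [NormedSpace ℝ V'] [NormedAddCommGroup V''] [NormedSpace ℝ V'']

/-- A vector valued function of class `Cⁿ` on the surface. -/
abbrev Reg (n : ℕ∞ω) (f : M → V) : Prop := ContMDiff (𝓡 2) 𝓘(ℝ, V) n f

lemma Reg.mdiff {f : M → V} (hf : Reg 1 f) (p : M) :
    MDifferentiableAt (𝓡 2) 𝓘(ℝ, V) f p := (hf p).mdifferentiableAt (by simp)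

lemma Reg.bilin {n : ℕ∞ω} (B : V →L[ℝ] V' →L[ℝ] V'') {f : M → V} {g : M → V'} (hf : Reg n f)
    (hg : Reg n g) : Reg n (fun p => B (f p) (g p)) :=
  B.isBoundedBilinearMap.contDiff.comp_contMDiff (hf.prodMk_space hg)

/-- The product rules for scalar multiples, inner products and operators applied to fields are all
instances of this one Leibniz rule. -/
lemma diff_bilin (B : V →L[ℝ] V' →L[ℝ] V'') {f : M → V} {g : M → V'} (hf : Reg 1 f)
    (hg : Reg 1 g) (p : M) (v : Plane) :
    diff (fun p => B (f p) (g p)) p v = B (diff f p v) (g p) + B (f p) (diff g p v) := by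
  have hfp := hf.mdiff p
  have hgp := hg.mdiff p
  have hB := B.isBoundedBilinearMap.hasFDerivAt (f p, g p)
  have h1 : HasMFDerivAt (𝓡 2) 𝓘(ℝ, V × V') (fun p => (f p, g p)) p
      ((diff f p).prod (diff g p)) := by
    -- The manifold structure of the vector space `V × V'` is replaced by the product structure that
    -- `prodMk` produces.
    rw [modelWithCornersSelf_prod, ← chartedSpaceSelf_prod]
    exact hfp.hasMFDerivAt.prodMk hgp.hasMFDerivAt
  have h2 := (hB.hasMFDerivAt.comp p h1).mfderiv
  have h3 : diff (fun p => B (f p) (g p)) p =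
    (B.isBoundedBilinearMap.deriv (f p, g p)) ∘L ((diff f p).prod (diff g p)) := h2
  rw [h3]
  simp [IsBoundedBilinearMap.deriv, add_comm]

lemma diff_add {f g : M → V} (hf : Reg 1 f) (hg : Reg 1 g) (p : M) :
    diff (fun p => f p + g p) p = diff f p + diff g p :=
  mfderiv_add (hf.mdiff p) (hg.mdiff p)

lemma diff_congr {f g : M → V} {p : M} (h : f =ᶠ[𝓝 p] g) : diff f p = diff g p :=
  h.mfderiv_eq

lemma diff_const (v : V) (p : M) : diff (fun _ : M => v) p = 0 := mfderiv_const

variable (r : M → Space)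

lemma tderiv_congr {f g : M → V} {p : M} (h : f =ᶠ[𝓝 p] g) : tderiv r f p = tderiv r g p := by
  rw [tderiv, tderiv, diff_congr h]

lemma tderiv_const (v : V) (p : M) : tderiv r (fun _ : M => v) p = 0 := by
  rw [tderiv, diff_const, ContinuousLinearMap.zero_comp]

lemma tderiv_add {f g : M → V} (hf : Reg 1 f) (hg : Reg 1 g) (p : M) :
    tderiv r (fun p => f p + g p) p = tderiv r f p + tderiv r g p := by
  rw [tderiv, diff_add hf hg, ContinuousLinearMap.add_comp]; rfl

lemma tderiv_bilin (B : V →L[ℝ] V' →L[ℝ] V'') {f : M → V} {g : M → V'} (hf : Reg 1 f)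
    (hg : Reg 1 g) (p : M) (v : Space) :
    tderiv r (fun p => B (f p) (g p)) p v = B (tderiv r f p v) (g p) + B (f p) (tderiv r g p v) :=
  diff_bilin B hf hg p _

lemma tderiv_smul {f : M → ℝ} {W : M → V} (hf : Reg 1 f) (hW : Reg 1 W) (p : M) (v : Space) :
    tderiv r (fun p => f p • W p) p v = tderiv r f p v • W p + f p • tderiv r W p v :=
  tderiv_bilin r (ContinuousLinearMap.lsmul ℝ ℝ) hf hW p v

lemma tderiv_inner {Y W : M → Space} (hY : Reg 1 Y) (hW : Reg 1 W) (p : M) (v : Space) :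
    tderiv r (fun p => ⟪Y p, W p⟫_ℝ) p v = ⟪tderiv r Y p v, W p⟫_ℝ + ⟪Y p, tderiv r W p v⟫_ℝ :=
  tderiv_bilin r (innerSL ℝ) hY hW p v

lemma tderiv_clm_apply {B : M → V →L[ℝ] V'} {W : M → V} (hB : Reg 1 B) (hW : Reg 1 W) (p : M)
    (v : Space) :
    tderiv r (fun p => B p (W p)) p v = tderiv r B p v (W p) + B p (tderiv r W p v) :=
  tderiv_bilin r (ContinuousLinearMap.id ℝ (V →L[ℝ] V')) hB hW p v

lemma Reg.smul {n : ℕ∞ω} {f : M → ℝ} {W : M → V} (hf : Reg n f) (hW : Reg n W) :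
    Reg n (fun p => f p • W p) := Reg.bilin (ContinuousLinearMap.lsmul ℝ ℝ) hf hW

lemma Reg.clm_apply {n : ℕ∞ω} {B : M → V →L[ℝ] V'} {W : M → V} (hB : Reg n B) (hW : Reg n W) :
    Reg n (fun p => B p (W p)) := Reg.bilin (ContinuousLinearMap.id ℝ (V →L[ℝ] V')) hB hW

lemma Reg.clm_comp {n : ℕ∞ω} {B : M → V' →L[ℝ] V''} {C : M → V →L[ℝ] V'} (hB : Reg n B)
    (hC : Reg n C) : Reg n (fun p => B p ∘L C p) :=
  Reg.bilin (ContinuousLinearMap.compL ℝ V V' V'') hB hC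

lemma Reg.clm {n : ℕ∞ω} (B : V →L[ℝ] V') {f : M → V} (hf : Reg n f) : Reg n (fun p => B (f p)) :=
  B.contDiff.comp_contMDiff hf

end TangentialDerivative

/-! ### Projection, gradient and regularity along an immersion -/

section Immersed

variable {M : Type*} [TopologicalSpace M] [ChartedSpace Plane M]
variable {V : Type*} [NormedAddCommGroup V] [NormedSpace ℝ V]
variable {r N : M → Space}

lemma pullTangent_eq (r : M → Space) (p : M) : pullTangent r p = leftInv (diff r p) := rfl

lemma tanProj_eq (hr : IsSmoothImmersion r) (p : M) :
    tanProj r p = diff r p ∘L pullTangent r p :=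
  starProjection_range (hr.2 p)

lemma tanProj_apply (hr : IsSmoothImmersion r) (hN : IsUnitNormal r N) (p : M) (v : Space) :
    tanProj r p v = v - ⟪N p, v⟫_ℝ • N p := by
  rw [tanProj_eq hr, pullTangent_eq, ContinuousLinearMap.comp_apply,
    comp_leftInv_apply (hr.2 p) (hN.2.1 p) (hN.2.2 p)]

lemma pullTangent_normal (hN : IsUnitNormal r N) (p : M) : pullTangent r p (N p) = 0 :=
  leftInv_normal (hN.2.2 p)

lemma tderiv_normal (hN : IsUnitNormal r N) (f : M → V) (p : M) : tderiv r f p (N p) = 0 := by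
  rw [tderiv, ContinuousLinearMap.comp_apply, pullTangent_normal hN, map_zero]

lemma tanProj_of_inner_eq_zero (hr : IsSmoothImmersion r) (hN : IsUnitNormal r N) {p : M}
    {v : Space} (hv : ⟪N p, v⟫_ℝ = 0) : tanProj r p v = v := by
  rw [tanProj_apply hr hN, hv]; simp

lemma inner_normal_tanProj (hr : IsSmoothImmersion r) (hN : IsUnitNormal r N) (p : M)
    (v : Space) : ⟪N p, tanProj r p v⟫_ℝ = 0 := by
  rw [tanProj_apply hr hN, inner_sub_right, inner_smul_right, real_inner_self_eq_norm_sq, hN.2.1]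
  simp

lemma inner_tanProj_left (r : M → Space) (p : M) (v w : Space) :
    ⟪tanProj r p v, w⟫_ℝ = ⟪v, tanProj r p w⟫_ℝ :=
  Submodule.inner_starProjection_left_eq_right _ _ _

/-- The projection is `1 - N ⊗ N`, which is polynomial in the smooth field `N`. -/
lemma reg_tanProj (hr : IsSmoothImmersion r) (hN : IsUnitNormal r N) :
    Reg ∞ (fun p => tanProj r p) := by
  have h : (fun p => tanProj r p) = fun p => ContinuousLinearMap.id ℝ Space -
      ContinuousLinearMap.smulRightL ℝ Space Space (innerSL ℝ (N p)) (N p) := by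
    ext1 p; ext1 v
    rw [tanProj_apply hr hN]
    simp
  rw [h]
  have h1 : Reg ∞ N := hN.1
  exact contMDiff_const.sub (Reg.bilin _ (Reg.clm (innerSL ℝ) h1) h1)

lemma inner_grad (r : M → Space) (f : M → ℝ) (p : M) (v : Space) :
    ⟪grad r f p, v⟫_ℝ = tderiv r f p v := by
  rw [grad, InnerProductSpace.toDual_symm_apply]

lemma inner_normal_grad (hN : IsUnitNormal r N) (f : M → ℝ) (p : M) :
    ⟪N p, grad r f p⟫_ℝ = 0 := by
  rw [real_inner_comm, inner_grad, tderiv_normal hN]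

section Regularity

variable [IsManifold (𝓡 2) ∞ M]

lemma Reg.tderiv (hr : IsSmoothImmersion r) {m n : ℕ∞ω} (hn : n ≤ ∞) (hmn : m + 1 ≤ n)
    {f : M → V} (hf : Reg n f) : Reg m (tderiv r f) := contMDiff_tderiv hr hn hmn hf

lemma Reg.grad (hr : IsSmoothImmersion r) {m n : ℕ∞ω} (hn : n ≤ ∞) (hmn : m + 1 ≤ n)
    {f : M → ℝ} (hf : Reg n f) : Reg m (grad r f) := by
  have h : Reg m (ImmersedSurface.tderiv r f) := hf.tderiv hr hn hmn
  let L : (Space →L[ℝ] ℝ) →L[ℝ] Space := LinearMap.toContinuousLinearMap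
    { toFun := fun l => (InnerProductSpace.toDual ℝ Space).symm l
      map_add' := fun l l' => map_add _ l l'
      map_smul' := fun a l => by simp }
  exact Reg.clm L h

lemma Reg.covDeriv (hr : IsSmoothImmersion r) (hN : IsUnitNormal r N) {m n : ℕ∞ω} (hn : n ≤ ∞)
    (hmn : m + 1 ≤ n) {Y : M → Space} (hY : Reg n Y) : Reg m (covDeriv r Y) :=
  Reg.clm_comp ((reg_tanProj hr hN).of_le ((le_self_add.trans hmn).trans hn))
    (hY.tderiv hr hn hmn)

/-- The trace on endomorphisms of space, as a continuous linear map. -/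
def traceSpace : (Space →L[ℝ] Space) →L[ℝ] ℝ :=
  LinearMap.toContinuousLinearMap
    ((LinearMap.trace ℝ Space) ∘ₗ (ContinuousLinearMap.coeLM ℝ))

omit [IsManifold (𝓡 2) ∞ M] in
lemma traceSpace_apply (A : Space →L[ℝ] Space) :
    traceSpace A = LinearMap.trace ℝ Space A.toLinearMap := rfl

lemma Reg.laplacian (hr : IsSmoothImmersion r) (hN : IsUnitNormal r N) {m n : ℕ∞ω} (hn : n ≤ ∞)
    (hmn : m + 1 + 1 ≤ n) {f : M → ℝ} (hf : Reg n f) : Reg m (laplacian r f) :=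
  Reg.clm traceSpace (Reg.covDeriv hr hN ((le_self_add.trans hmn).trans hn) le_rfl
    (hf.grad hr hn hmn))

lemma Reg.adjField (hr : IsSmoothImmersion r) (hN : IsUnitNormal r N) {m n : ℕ∞ω} (hn : n ≤ ∞)
    (hmn : m + 1 ≤ n) {Y : M → Space} (hY : Reg n Y) : Reg m (adjField r Y) :=
  (Reg.clm traceSpace (Reg.covDeriv hr hN hn hmn hY)).neg

lemma Reg.adjTensor (hr : IsSmoothImmersion r) (hN : IsUnitNormal r N) {m n : ℕ∞ω} (hn : n ≤ ∞)
    (hmn : m + 1 ≤ n) {B : M → Space →L[ℝ] Space} (hB : Reg n B) : Reg m (adjTensor r B) := by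
  have h1 : Reg m (fun p => tanProj r p) :=
    (reg_tanProj hr hN).of_le ((le_self_add.trans hmn).trans hn)
  have h2 : Reg m (ImmersedSurface.tderiv r B) := hB.tderiv hr hn hmn
  refine ContMDiff.neg (contMDiff_finsetSum fun i _ => ?_)
  exact Reg.clm_apply (Reg.clm_comp h1 (Reg.clm_comp (Reg.clm_apply h2 contMDiff_const) h1))
    contMDiff_const

lemma reg_secondForm (hr : IsSmoothImmersion r) (hN : IsUnitNormal r N) :
    Reg ∞ (secondForm r N) :=
  (Reg.tderiv (V := Space) hr (n := ∞) (m := ∞) le_rfl le_rfl hN.1).neg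

end Regularity

end Immersed

/-! ### Trace and determinant of endomorphisms of the plane -/

/-- The trace on endomorphisms of the plane, as a continuous linear map. -/
def tracePlane : (Plane →L[ℝ] Plane) →L[ℝ] ℝ :=
  LinearMap.toContinuousLinearMap
    ((LinearMap.trace ℝ Plane) ∘ₗ (ContinuousLinearMap.coeLM ℝ))

lemma tracePlane_apply (A : Plane →L[ℝ] Plane) :
    tracePlane A = LinearMap.trace ℝ Plane A.toLinearMap := rfl

lemma tracePlane_coord (A : Plane →L[ℝ] Plane) :
    tracePlane A = A (EuclideanSpace.single 0 1) 0 + A (EuclideanSpace.single 1 1) 1 := by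
  rw [tracePlane_apply,
    LinearMap.trace_eq_matrix_trace ℝ (EuclideanSpace.basisFun (Fin 2) ℝ).toBasis,
    Matrix.trace_fin_two]
  simp [LinearMap.toMatrix_apply]

lemma det_coord (A : Plane →L[ℝ] Plane) :
    A.det = (A (EuclideanSpace.single 0 1)) 0 * (A (EuclideanSpace.single 1 1)) 1
        - (A (EuclideanSpace.single 1 1)) 0 * (A (EuclideanSpace.single 0 1)) 1 := by
  have := LinearMap.det_toMatrix (EuclideanSpace.basisFun (Fin 2) ℝ).toBasis A.toLinearMap
  rw [ContinuousLinearMap.det, ← this, Matrix.det_fin_two]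
  simp [LinearMap.toMatrix_apply]

lemma clm_plane_apply (A : Plane →L[ℝ] Plane) (v : Plane) (i : Fin 2) :
    A v i = v 0 * A (EuclideanSpace.single 0 1) i + v 1 * A (EuclideanSpace.single 1 1) i := by
  have hv : v = v 0 • EuclideanSpace.single 0 (1 : ℝ) + v 1 • EuclideanSpace.single 1 (1 : ℝ) := by
    ext i; fin_cases i <;> simp
  conv_lhs => rw [hv]
  simp

lemma tracePlane_comp_comm (A B : Plane →L[ℝ] Plane) :
    tracePlane (A ∘L B) = tracePlane (B ∘L A) :=
  LinearMap.trace_comp_comm' (A : Plane →ₗ[ℝ] Plane) (B : Plane →ₗ[ℝ] Plane) |>.symm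

lemma tracePlane_adjoint (A : Plane →L[ℝ] Plane) : tracePlane (adjoint A) = tracePlane A := by
  have h : ∀ i j : Fin 2, adjoint A (EuclideanSpace.single i 1) j =
      A (EuclideanSpace.single j 1) i := by
    intro i j
    have h1 := ContinuousLinearMap.adjoint_inner_right A (EuclideanSpace.single j (1 : ℝ))
      (EuclideanSpace.single i (1 : ℝ))
    simpa [EuclideanSpace.inner_single_left, EuclideanSpace.inner_single_right] using h1
  rw [tracePlane_coord, tracePlane_coord, h, h]

/-- Cyclicity of the trace moves `G` next to its left inverse. Traces of tangential operators on
space become traces on the coordinate plane. -/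
lemma trace_leftInv {G : Plane →L[ℝ] Space} (hG : Function.Injective G) (A : Plane →L[ℝ] Plane) :
    traceSpace (G ∘L A ∘L leftInv G) = tracePlane A := by
  rw [traceSpace_apply, tracePlane_apply]
  have := LinearMap.trace_comp_comm' (G : Plane →ₗ[ℝ] Space)
    ((A ∘L leftInv G : Space →L[ℝ] Plane) : Space →ₗ[ℝ] Plane)
  refine this.symm.trans ?_
  congr 1
  ext1 v
  simp [leftInv_apply_self hG]

/-- The Cayley-Hamilton theorem in the plane. -/
lemma comp_self_plane (A : Plane →L[ℝ] Plane) :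
    A ∘L A = tracePlane A • A - A.det • ContinuousLinearMap.id ℝ Plane := by
  ext v i
  simp only [ContinuousLinearMap.comp_apply, sub_apply,
    smul_apply, PiLp.sub_apply, PiLp.smul_apply, smul_eq_mul,
    ContinuousLinearMap.id_apply]
  rw [clm_plane_apply A (A v), clm_plane_apply A v, clm_plane_apply A v, clm_plane_apply A v,
    tracePlane_coord, det_coord]
  fin_cases i <;> simp <;> ring

/-- The differential of the determinant. -/
lemma hasFDerivAt_clm_det (A : Plane →L[ℝ] Plane) :
    HasFDerivAt (fun A : Plane →L[ℝ] Plane => A.det)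
      (tracePlane A • tracePlane -
        tracePlane ∘L (ContinuousLinearMap.compL ℝ Plane Plane Plane A)) A := by
  have hev : ∀ (v : Plane) (i : Fin 2), HasFDerivAt (fun A : Plane →L[ℝ] Plane => A v i)
      ((EuclideanSpace.proj i : Plane →L[ℝ] ℝ) ∘L ContinuousLinearMap.apply ℝ Plane v) A :=
    fun v i => ((EuclideanSpace.proj i : Plane →L[ℝ] ℝ) ∘L
      ContinuousLinearMap.apply ℝ Plane v).hasFDerivAt
  have h := ((hev (EuclideanSpace.single 0 1) 0).mul (hev (EuclideanSpace.single 1 1) 1)).sub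
    ((hev (EuclideanSpace.single 1 1) 0).mul (hev (EuclideanSpace.single 0 1) 1))
  refine (h.congr_fderiv ?_).congr_of_eventuallyEq (Filter.Eventually.of_forall det_coord)
  ext H
  simp only [sub_apply, smul_apply,
    add_apply, ContinuousLinearMap.comp_apply, smul_eq_mul,
    ContinuousLinearMap.apply_apply, PiLp.proj_apply, ContinuousLinearMap.compL_apply]
  rw [tracePlane_coord, tracePlane_coord, tracePlane_coord, ContinuousLinearMap.comp_apply,
    ContinuousLinearMap.comp_apply, clm_plane_apply A (H _), clm_plane_apply A (H _)]
  ring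

/-- Cayley-Hamilton multiplied by the inverse reads `tr A - A = det A • A⁻¹`; this brings the
differential of the determinant to Jacobi's form. -/
lemma tracePlane_mul_sub {A : Plane →L[ℝ] Plane} (hA : A.IsInvertible) (H : Plane →L[ℝ] Plane) :
    tracePlane A * tracePlane H - tracePlane (A ∘L H) = A.det * tracePlane (A.inverse ∘L H) := by
  have h1 : tracePlane A • H - A ∘L H = A.det • (A.inverse ∘L H) := by
    have h2 := congrArg (fun B => A.inverse ∘L B ∘L H) (comp_self_plane A)
    ext1 v
    have h3 := DFunLike.congr_fun h2 v
    simp only [ContinuousLinearMap.comp_apply, sub_apply,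
      smul_apply, ContinuousLinearMap.id_apply, map_sub, map_smul,
      hA.inverse_apply_self] at h3 ⊢
    rw [h3]; abel
  have := congrArg tracePlane h1
  simpa using this

lemma inner_gram_right (G : Plane →L[ℝ] Space) (v w : Plane) :
    ⟪v, gram G w⟫_ℝ = ⟪G v, G w⟫_ℝ := by
  rw [real_inner_comm, inner_gram, real_inner_comm]

lemma adjoint_inverse_gram {G : Plane →L[ℝ] Space} (hG : Function.Injective G) :
    adjoint (gram G).inverse = (gram G).inverse := by
  refine ContinuousLinearMap.ext fun v => ext_inner_right ℝ fun w => ?_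
  have hI := gram_isInvertible hG
  rw [ContinuousLinearMap.adjoint_inner_left]
  conv_lhs => rw [← hI.self_apply_inverse v]
  conv_rhs => rw [← hI.self_apply_inverse w]
  rw [inner_gram, inner_gram_right]

/-- The area element of a linear map. -/
lemma hasFDerivAt_sqrt_det_gram {G : Plane →L[ℝ] Space} (hG : Function.Injective G) :
    HasFDerivAt (fun G => √(gram G).det)
      (√(gram G).det • (tracePlane ∘L (ContinuousLinearMap.compL ℝ Plane Space Plane (leftInv G))))
      G := by
  have hI := gram_isInvertible hG
  have hg : HasFDerivAt gram _ G := adjointCLM.hasFDerivAt.clm_comp (hasFDerivAt_id G)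
  have h := ((hasFDerivAt_clm_det (gram G)).comp G hg).sqrt (det_gram_pos hG).ne'
  refine h.congr_fderiv ?_
  ext H
  have hpos := Real.sqrt_pos.2 (det_gram_pos hG)
  have hsq := Real.sq_sqrt (det_gram_pos hG).le
  -- The derivative of `G† G` is `H† G + G† H`. The trace is invariant under the adjoint and the
  -- inverse Gram operator is self-adjoint, so both halves contribute equally and the factor two
  -- cancels the one from the square root.
  have h1 : tracePlane ((gram G).inverse ∘L (adjoint H ∘L G)) = tracePlane (leftInv G ∘L H) := by
    rw [tracePlane_comp_comm, ← tracePlane_adjoint]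
    simp only [ContinuousLinearMap.adjoint_comp, adjoint_inverse_gram hG,
      ContinuousLinearMap.adjoint_adjoint]
    rfl
  have h2 : tracePlane ((gram G).inverse ∘L (adjoint G ∘L H)) = tracePlane (leftInv G ∘L H) := rfl
  have h3 := tracePlane_mul_sub hI (adjoint H ∘L G + adjoint G ∘L H)
  rw [ContinuousLinearMap.comp_add (gram G).inverse,
    map_add tracePlane ((gram G).inverse ∘L _), h1, h2] at h3
  simp only [smul_apply, ContinuousLinearMap.comp_apply,
    sub_apply, smul_eq_mul, ContinuousLinearMap.compL_apply,
    add_apply, Function.comp_apply, adjointCLM_apply,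
    ContinuousLinearMap.flip_apply, ContinuousLinearMap.id_apply]
  rw [add_comm (adjoint G ∘L H), h3]
  field_simp
  rw [hsq]; ring

/-! ### The divergence theorem -/

lemma two_le_infty : (2 : ℕ∞ω) ≤ ∞ := WithTop.coe_le_coe.2 (le_top : (2 : ℕ∞) ≤ ⊤)

lemma one_add_one_le_infty : (1 : ℕ∞ω) + 1 ≤ ∞ := one_add_one_eq_two.trans_le two_le_infty

/-- Each diagonal partial derivative of a compactly supported field integrates to zero. -/
lemma integral_trace_fderiv_eq_zero {Z : Plane → Plane} (hZ : ContDiff ℝ 1 Z)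
    (hs : HasCompactSupport Z) : ∫ x, tracePlane (fderiv ℝ Z x) = 0 := by
  have hd : ∀ x, DifferentiableAt ℝ Z x := fun x => hZ.contDiffAt.differentiableAt (by simp)
  have hcont : Continuous (fderiv ℝ Z) := hZ.continuous_fderiv (by simp)
  have hpart : ∀ (i : Fin 2), Integrable (fun x => fderiv ℝ Z x (EuclideanSpace.single i 1) i) ∧
      ∫ x, fderiv ℝ Z x (EuclideanSpace.single i 1) i = 0 := by
    intro i
    have hZi : ContDiff ℝ 1 (fun x => Z x i) := by fun_prop
    have hsi : HasCompactSupport (fun x => Z x i) :=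
      hs.comp_left (g := fun v : Plane => v i) (by simp)
    have h1 : ∀ x, fderiv ℝ (fun x => Z x i) x (EuclideanSpace.single i 1) =
        fderiv ℝ Z x (EuclideanSpace.single i 1) i := by
      intro x
      have := ((EuclideanSpace.proj i : Plane →L[ℝ] ℝ).hasFDerivAt.comp x
        (hd x).hasFDerivAt).fderiv
      have h2 : fderiv ℝ (fun x => Z x i) x = (EuclideanSpace.proj i : Plane →L[ℝ] ℝ) ∘L fderiv ℝ Z x :=
        this
      rw [h2]; simp
    have hint : Integrable (fun x => fderiv ℝ (fun x => Z x i) x (EuclideanSpace.single i 1)) := by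
      refine Continuous.integrable_of_hasCompactSupport ?_ ?_
      · exact (hZi.continuous_fderiv (by simp)).clm_apply continuous_const
      · exact hsi.fderiv_apply (𝕜 := ℝ) _
    -- Integration by parts against the constant `1`, whose derivative vanishes.
    have h3 := integral_mul_fderiv_eq_neg_fderiv_mul_of_integrable (μ := (volume : Measure Plane))
      (f := fun _ => (1 : ℝ)) (g := fun x => Z x i) (v := EuclideanSpace.single i 1)
      (by simp) (by simpa using hint)
      (by simpa using hZi.continuous.integrable_of_hasCompactSupport hsi)
      (by simp) (fun x _ => hZi.contDiffAt.differentiableAt (by simp))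
    simp only [h1, one_mul] at h3 hint
    refine ⟨hint, ?_⟩
    simpa using h3
  simp only [tracePlane_coord]
  rw [integral_add (hpart 0).1 (hpart 1).1, (hpart 0).2, (hpart 1).2, add_zero]

section Coordinates

/-- The divergence of a tangent field `dX(y)` in coordinates. -/
lemma trace_fderiv_areaDensity_smul {X : Plane → Space} {y : Plane → Plane} {x : Plane}
    (hX : ContDiffAt ℝ ∞ X x) (hinj : Function.Injective (fderiv ℝ X x))
    (hy : DifferentiableAt ℝ y x) :
    tracePlane (fderiv ℝ (fun x => areaDensity X x • y x) x) =
      areaDensity X x * tracePlane (leftInv (fderiv ℝ X x) ∘L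
        fderiv ℝ (fun x => fderiv ℝ X x (y x)) x) := by
  have hX2 : DifferentiableAt ℝ (fderiv ℝ X) x :=
    (hX.fderiv_right (m := 1) one_add_one_le_infty).differentiableAt (by simp)
  have hden := ((hasFDerivAt_sqrt_det_gram hinj).comp x hX2.hasFDerivAt).congr_of_eventuallyEq
    (f₁ := areaDensity X) (Filter.Eventually.of_forall fun z => areaDensity_eq X z)
  have h1 := (hden.smul hy.hasFDerivAt).fderiv
  have h2 : fderiv ℝ (fun x => fderiv ℝ X x (y x)) x = _ :=
    (hX2.hasFDerivAt.clm_apply hy.hasFDerivAt).fderiv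
  have hsymm : ∀ v w, fderiv ℝ (fderiv ℝ X) x v w = fderiv ℝ (fderiv ℝ X) x w v :=
    (hX.isSymmSndFDerivAt (by simpa using two_le_infty)).eq
  have h3 : ∀ l : Plane →L[ℝ] ℝ, ∀ v : Plane, tracePlane (l.smulRight v) = l v := by
    intro l v
    rw [tracePlane_coord]
    have hv : v = v 0 • EuclideanSpace.single 0 (1 : ℝ) + v 1 • EuclideanSpace.single 1 (1 : ℝ) := by
      ext i; fin_cases i <;> simp
    conv_rhs => rw [hv]
    simp [mul_comm]
  -- Differentiating the density in the direction `y` produces `D²X(y, ·)`, while differentiating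
  -- the field `dX(y)` produces `D²X(·, y)`. Symmetry of the second derivative identifies them.
  have h4 : leftInv (fderiv ℝ X x) ∘L ((fderiv ℝ (fderiv ℝ X) x).flip (y x)) =
      leftInv (fderiv ℝ X x) ∘L (fderiv ℝ (fderiv ℝ X) x (y x)) := by
    ext1 v; simp [hsymm v]
  have h5 : leftInv (fderiv ℝ X x) ∘L (fderiv ℝ X x ∘L fderiv ℝ y x) = fderiv ℝ y x := by
    ext1 v; simp [leftInv_apply_self hinj]
  have h1' : fderiv ℝ (fun x => areaDensity X x • y x) x = _ := h1
  rw [h1', h2, map_add, h3, ContinuousLinearMap.comp_add, h5, h4, map_add, map_smul]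
  simp only [ContinuousLinearMap.comp_apply, smul_apply, smul_eq_mul,
    ContinuousLinearMap.compL_apply]
  rw [areaDensity_eq]
  ring

end Coordinates

section Divergence

variable {M : Type*} [TopologicalSpace M] [ChartedSpace Plane M] [IsManifold (𝓡 2) ∞ M]
  {r N : M → Space}

/-- The divergence of a tangent field. -/
def divg (r : M → Space) (W : M → Space) (p : M) : ℝ := traceSpace (covDeriv r W p)

lemma adjField_eq_neg_divg (r : M → Space) (W : M → Space) (p : M) :
    adjField r W p = -divg r W p := rfl

lemma covDeriv_chart (hr : IsSmoothImmersion r) {W : M → Space} (hW : Reg 1 W) (c : M)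
    {x : Plane} (hx : x ∈ (chartAt Plane c).target) :
    covDeriv r W ((chartAt Plane c).symm x) =
      fderiv ℝ (r ∘ (chartAt Plane c).symm) x ∘L
        (leftInv (fderiv ℝ (r ∘ (chartAt Plane c).symm) x) ∘L
          fderiv ℝ (W ∘ (chartAt Plane c).symm) x) ∘L
            leftInv (fderiv ℝ (r ∘ (chartAt Plane c).symm) x) := by
  have hrd := (hr.1 ((chartAt Plane c).symm x)).mdifferentiableAt (by simp)
  have hinj := injective_fderiv_chart hr c hx
  have h2 : ∀ (U U' : Submodule ℝ Space), U = U' → U.starProjection = U'.starProjection := by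
    rintro U _ rfl; rfl
  have h1 : tanProj r ((chartAt Plane c).symm x) =
      fderiv ℝ (r ∘ (chartAt Plane c).symm) x ∘L
        leftInv (fderiv ℝ (r ∘ (chartAt Plane c).symm) x) := by
    rw [← starProjection_range hinj, tanProj]
    exact h2 _ _ (by rw [← tangentPlane_chart c hx hrd, tangentPlane, diff_plane])
  rw [covDeriv, tderiv_chart c hx hrd (hW.mdiff _), h1]
  rfl

lemma divg_chart (hr : IsSmoothImmersion r) {W : M → Space} (hW : Reg 1 W) (c : M)
    {x : Plane} (hx : x ∈ (chartAt Plane c).target) :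
    divg r W ((chartAt Plane c).symm x) =
      tracePlane (leftInv (fderiv ℝ (r ∘ (chartAt Plane c).symm) x) ∘L
        fderiv ℝ (W ∘ (chartAt Plane c).symm) x) := by
  rw [divg, covDeriv_chart hr hW c hx, trace_leftInv (injective_fderiv_chart hr c hx)]

lemma divg_congr {W W' : M → Space} {p : M} (h : W =ᶠ[𝓝 p] W') : divg r W p = divg r W' p := by
  rw [divg, divg, covDeriv, covDeriv, tderiv_congr r h]

lemma divg_zero (p : M) : divg r (fun _ => 0) p = 0 := by
  rw [divg, covDeriv, tderiv_const]; simp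

lemma divg_eq_zero_of_notMem {W : M → Space} {p : M} (hp : p ∉ tsupport W) :
    divg r W p = 0 := by
  rw [divg_congr (notMem_tsupport_iff_eventuallyEq.1 hp)]
  exact divg_zero p

lemma divg_add {W W' : M → Space} (hW : Reg 1 W) (hW' : Reg 1 W') (p : M) :
    divg r (fun p => W p + W' p) p = divg r W p + divg r W' p := by
  rw [divg, covDeriv, tderiv_add r hW hW', ContinuousLinearMap.comp_add, map_add]
  rfl

lemma continuous_divg (hr : IsSmoothImmersion r) (hN : IsUnitNormal r N) {W : M → Space}
    (hW : Reg 1 W) : Continuous (divg r W) :=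
  (Reg.clm traceSpace (Reg.covDeriv (m := 0) hr hN (by simp) (by simp) hW)).continuous

variable [MeasurableSpace M] [BorelSpace M] [SecondCountableTopology M] [T2Space M]

/-- In coordinates the divergence times the area density is the flat divergence of the density times
the coordinate field, so the claim reduces to the plane. -/
lemma integral_divg_eq_zero_of_subset_chart (hr : IsSmoothImmersion r) (hN : IsUnitNormal r N)
    {W : M → Space} (hW : Reg 1 W) (hWN : ∀ p, ⟪N p, W p⟫_ℝ = 0) (hs : HasCompactSupport W)
    (c : M) (hc : tsupport W ⊆ (chartAt Plane c).source) :
    ∫ p, divg r W p ∂(area r) = 0 := by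
  set e := chartAt Plane c with he
  have h0 : ∀ p ∉ e.source, divg r W p = 0 := fun p hp =>
    divg_eq_zero_of_notMem fun h => hp (hc h)
  rw [← setIntegral_eq_integral_of_forall_compl_eq_zero h0,
    setIntegral_area_chart hr.1 c (continuous_divg hr hN hW).aestronglyMeasurable]
  set X := r ∘ e.symm with hX
  -- `y` is the coordinate expression of `W`, so `dX(y) = W` because `W` is tangent. Extending the
  -- weighted field by zero outside the target keeps it `C¹`, since its support lies in the compact
  -- image of the support of `W`.
  set y : Plane → Plane := fun x => leftInv (fderiv ℝ X x) (W (e.symm x)) with hy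
  set Z : Plane → Plane := e.target.indicator (fun x => areaDensity X x • y x) with hZ
  have hXs : ∀ x ∈ e.target, ContDiffAt ℝ ∞ X x := fun x hx => contDiffAt_comp_chart hr.1 c hx
  have hinj : ∀ x ∈ e.target, Function.Injective (fderiv ℝ X x) :=
    fun x hx => injective_fderiv_chart hr c hx
  have hy1 : ∀ x ∈ e.target, ContDiffAt ℝ 1 y x := fun x hx =>
    ((contDiffAt_leftInv (hinj x hx)).comp x
      ((hXs x hx).fderiv_right (m := 1) one_add_one_le_infty)).clm_apply
      ((contMDiffAt_iff_chart (by exact_mod_cast le_top) c hx).1 (hW _))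
  have hWy : ∀ x ∈ e.target, W (e.symm x) = fderiv ℝ X x (y x) := by
    intro x hx
    have h1 := fderiv_comp_chart c hx ((hr.1 (e.symm x)).mdifferentiableAt (by simp))
    rw [hy]
    have h2 := comp_leftInv_apply (hinj x hx) (hN.2.1 (e.symm x)) (fun v => by
      rw [hX, h1]; exact hN.2.2 _ _) (W (e.symm x))
    rw [h2, hWN]; simp
  have hZeq : ∀ x ∈ e.target, Z =ᶠ[𝓝 x] fun x => areaDensity X x • y x := fun x hx => by
    filter_upwards [mem_nhds_chart_target c hx] with z hz
    exact Set.indicator_of_mem hz _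
  have hK : IsCompact (e '' tsupport W) := hs.isCompact.image_of_continuousOn
    (e.continuousOn.mono hc)
  have hZ0 : ∀ x ∉ e '' tsupport W, Z x = 0 := by
    intro x hx
    by_cases hxt : x ∈ e.target
    · have : W (e.symm x) = 0 := image_eq_zero_of_notMem_tsupport fun h =>
        hx ⟨_, h, e.right_inv hxt⟩
      simp [hZ, hy, this]
    · exact Set.indicator_of_notMem hxt _
  have hZc : HasCompactSupport Z := HasCompactSupport.intro hK hZ0
  have hZ1 : ContDiff ℝ 1 Z := by
    refine contDiff_iff_contDiffAt.2 fun x => ?_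
    by_cases hxt : x ∈ e.target
    · have h1 : ContDiffAt ℝ 1 (areaDensity X) x := by
        have : areaDensity X = fun x => √(gram (fderiv ℝ X x)).det :=
          funext fun x => areaDensity_eq X x
        rw [this]
        exact ((contDiff_clm_det.comp contDiff_gram).contDiffAt.comp x
          ((hXs x hxt).fderiv_right (m := 1) one_add_one_le_infty)).sqrt
          (det_gram_pos (hinj x hxt)).ne'
      exact (h1.smul (hy1 x hxt)).congr_of_eventuallyEq (hZeq x hxt)
    · have hx : x ∉ e '' tsupport W := by
        rintro ⟨p, hp, rfl⟩
        exact hxt (e.map_source (hc hp))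
      refine (contDiffAt_const (c := (0 : Plane))).congr_of_eventuallyEq ?_
      filter_upwards [hK.isClosed.isOpen_compl.mem_nhds hx] with z hz
      exact hZ0 z hz
  have hcongr : ∀ x ∈ e.target, areaDensity X x * divg r W (e.symm x) =
      tracePlane (fderiv ℝ Z x) := by
    intro x hx
    have h1 : W ∘ e.symm =ᶠ[𝓝 x] fun x => fderiv ℝ X x (y x) := by
      filter_upwards [mem_nhds_chart_target c hx] with z hz
      exact hWy z hz
    rw [divg_chart hr hW c hx, (hZeq x hx).fderiv_eq, h1.fderiv_eq,
      trace_fderiv_areaDensity_smul (hXs x hx) (hinj x hx)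
        ((hy1 x hx).differentiableAt (by simp))]
  rw [setIntegral_congr_fun (measurableSet_chart_target c) hcongr]
  have hout : ∀ x ∉ e.target, tracePlane (fderiv ℝ Z x) = 0 := by
    intro x hxt
    have hx : x ∉ tsupport Z := fun h => by
      obtain ⟨p, hp, rfl⟩ := (closure_minimal (fun z hz => not_imp_comm.1 (hZ0 z) hz) hK.isClosed) h
      exact hxt (e.map_source (hc hp))
    rw [(notMem_tsupport_iff_eventuallyEq.1 hx).fderiv_eq]
    simp
  rw [setIntegral_eq_integral_of_forall_compl_eq_zero hout]
  exact integral_trace_fderiv_eq_zero hZ1 hZc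

/-- The divergence theorem for compactly supported tangent fields. -/
theorem integral_divg_eq_zero (hr : IsSmoothImmersion r) (hN : IsUnitNormal r N)
    {W : M → Space} (hW : Reg 1 W) (hWN : ∀ p, ⟪N p, W p⟫_ℝ = 0) (hs : HasCompactSupport W) :
    ∫ p, divg r W p ∂(area r) = 0 := by
  classical
  have : LocallyCompactSpace M := ChartedSpace.locallyCompactSpace Plane M
  have := isLocallyFiniteMeasure_area hr.1
  obtain ⟨f, hf⟩ := SmoothPartitionOfUnity.exists_isSubordinate (𝓡 2) (s := (Set.univ : Set M))
    isClosed_univ (fun c : M => (chartAt Plane c).source) (fun c => (chartAt Plane c).open_source)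
    (fun c _ => Set.mem_iUnion.2 ⟨c, mem_chart_source Plane c⟩)
  -- Only finitely many functions of the partition meet the support of `W`, so the decomposition
  -- into pieces lying in charts is a finite sum.
  have hfin := f.locallyFinite.finite_nonempty_inter_compact hs.isCompact
  set I := hfin.toFinset with hI
  have hfr : ∀ i, Reg 1 (f i) := fun i => (f i).contMDiff.of_le (by exact_mod_cast le_top)
  have hreg : ∀ i, Reg 1 (fun p => f i p • W p) := fun i => Reg.smul (hfr i) hW
  have hcomp : ∀ i, HasCompactSupport (fun p => f i p • W p) := fun i =>
    HasCompactSupport.intro hs.isCompact fun p hp => by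
      rw [image_eq_zero_of_notMem_tsupport hp, smul_zero]
  have hsum : W = fun p => ∑ i ∈ I, f i p • W p := by
    funext p
    by_cases hp : W p = 0
    · simp [hp]
    · have h1 := f.sum_eq_one (Set.mem_univ p)
      have h2 : ∑ᶠ i, f i p = ∑ i ∈ I, f i p := by
        refine finsum_eq_sum_of_support_subset _ fun i hi => ?_
        simp only [hI, Set.Finite.coe_toFinset, Set.mem_ofPred_eq]
        exact ⟨p, hi, subset_tsupport _ hp⟩
      rw [← Finset.sum_smul, ← h2, h1, one_smul]
  have hdiv : ∀ (J : Finset M), Reg 1 (fun p => ∑ i ∈ J, f i p • W p) ∧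
      ∀ p, divg r (fun p => ∑ i ∈ J, f i p • W p) p = ∑ i ∈ J, divg r (fun p => f i p • W p) p := by
    intro J
    induction J using Finset.induction_on with
    | empty => exact ⟨by simpa using contMDiff_const, fun p => by simpa using divg_zero p⟩
    | insert i J hi ih =>
      simp only [Finset.sum_insert hi]
      refine ⟨(hreg i).add ih.1, fun p => ?_⟩
      rw [divg_add (hreg i) ih.1, ih.2]
  have h3 : ∀ p, divg r W p = ∑ i ∈ I, divg r (fun p => f i p • W p) p := by
    intro p
    rw [← (hdiv I).2, ← hsum]
  simp only [h3]
  rw [integral_finsetSum]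
  · refine Finset.sum_eq_zero fun i _ => ?_
    refine integral_divg_eq_zero_of_subset_chart hr hN (hreg i) (fun p => ?_) (hcomp i) i ?_
    · rw [inner_smul_right, hWN, mul_zero]
    · exact (closure_mono (Function.support_smul_subset_left (f i) W)).trans (hf i)
  · intro i _
    refine (continuous_divg hr hN (hreg i)).integrable_of_hasCompactSupport ?_
    exact HasCompactSupport.intro (hcomp i).isCompact fun p hp => divg_eq_zero_of_notMem hp

end Divergence

/-! ### Second fundamental form and integration by parts -/

lemma traceSpace_eq_sum (A : Space →L[ℝ] Space) :
    traceSpace A = ∑ i : Fin 3, ⟪A (EuclideanSpace.single i 1), EuclideanSpace.single i 1⟫_ℝ := by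
  rw [traceSpace_apply, LinearMap.trace_eq_sum_inner _ (EuclideanSpace.basisFun (Fin 3) ℝ)]
  refine Finset.sum_congr rfl fun i _ => ?_
  rw [real_inner_comm, EuclideanSpace.basisFun_apply]
  rfl

lemma traceSpace_smulRight (l : Space →L[ℝ] ℝ) (v : Space) : traceSpace (l.smulRight v) = l v := by
  rw [traceSpace_eq_sum]
  have hv : v = ∑ i : Fin 3, v i • EuclideanSpace.single i (1 : ℝ) := by
    ext i; fin_cases i <;> simp [Fin.sum_univ_three]
  conv_rhs => rw [hv]
  simp [map_sum, EuclideanSpace.inner_single_right, mul_comm, inner_smul_left]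

/-- Differentiating `⟪n, dX v⟫ = 0`. -/
lemma inner_fderiv_normal {X n : Plane → Space} {x : Plane} (hX : ContDiffAt ℝ 2 X x)
    (hn : DifferentiableAt ℝ n x) (h : ∀ᶠ y in 𝓝 x, ∀ v, ⟪n y, fderiv ℝ X y v⟫_ℝ = 0)
    (v w : Plane) :
    ⟪fderiv ℝ n x w, fderiv ℝ X x v⟫_ℝ = -⟪n x, fderiv ℝ (fderiv ℝ X) x w v⟫_ℝ := by
  have hX2 : DifferentiableAt ℝ (fderiv ℝ X) x :=
    (hX.fderiv_right (m := 1) one_add_one_eq_two.le).differentiableAt (by simp)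
  have h1 : HasFDerivAt (fun y => ⟪n y, fderiv ℝ X y v⟫_ℝ) _ x :=
    hn.hasFDerivAt.inner ℝ (hX2.hasFDerivAt.clm_apply (hasFDerivAt_const v x))
  have h2 : (fun y => ⟪n y, fderiv ℝ X y v⟫_ℝ) =ᶠ[𝓝 x] fun _ => 0 := h.mono fun y hy => hy v
  have h3 := DFunLike.congr_fun (h1.unique ((hasFDerivAt_const (0 : ℝ) x).congr_of_eventuallyEq h2)) w
  simp at h3
  linarith

section

variable {M : Type*} [TopologicalSpace M] [ChartedSpace Plane M] [IsManifold (𝓡 2) ∞ M]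
  {r N : M → Space}

/-- In a chart both sides equal `-⟪n, D²X(·, ·)⟫`, so the symmetry of the second fundamental form is
that of the second derivative. -/
lemma inner_diff_normal_symm (hr : IsSmoothImmersion r) (hN : IsUnitNormal r N) (p : M)
    (a b : Plane) : ⟪diff N p a, diff r p b⟫_ℝ = ⟪diff N p b, diff r p a⟫_ℝ := by
  have key : ∀ (c : M) (x : Plane) (_ : x ∈ (chartAt Plane c).target) (a b : Plane),
      ⟪diff N ((chartAt Plane c).symm x) a, diff r ((chartAt Plane c).symm x) b⟫_ℝ =
        ⟪diff N ((chartAt Plane c).symm x) b, diff r ((chartAt Plane c).symm x) a⟫_ℝ := by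
    intro c x hx a b
    have hXs := contDiffAt_comp_chart hr.1 c hx
    have hNs := contDiffAt_comp_chart hN.1 c hx
    have hrd : ∀ q, MDifferentiableAt (𝓡 2) 𝓘(ℝ, Space) r q :=
      fun q => (hr.1 q).mdifferentiableAt (by simp)
    have h0 : ∀ᶠ y in 𝓝 x, ∀ v, ⟪(N ∘ (chartAt Plane c).symm) y,
        fderiv ℝ (r ∘ (chartAt Plane c).symm) y v⟫_ℝ = 0 := by
      filter_upwards [mem_nhds_chart_target c hx] with y hy v
      rw [fderiv_comp_chart c hy (hrd _)]
      exact hN.2.2 _ _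
    have h1 := inner_fderiv_normal (hXs.of_le two_le_infty) (hNs.differentiableAt (by simp)) h0
    have h2 := (hXs.isSymmSndFDerivAt (by simpa using two_le_infty)).eq
    have h3 := h1 ((chartDeriv c hx).symm b) ((chartDeriv c hx).symm a)
    rw [h2, ← h1, fderiv_comp_chart c hx (hrd _),
      fderiv_comp_chart c hx ((hN.1 _).mdifferentiableAt (by simp))] at h3
    simpa using h3
  have := key p _ (mem_chart_target Plane p) a b
  rwa [(chartAt Plane p).left_inv (mem_chart_source Plane p)] at this

lemma inner_normal_diff (hN : IsUnitNormal r N) (p : M) (a : Plane) :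
    ⟪N p, diff N p a⟫_ℝ = 0 := by
  have hN1 : Reg 1 N := hN.1.of_le (by simp)
  have h1 := diff_bilin (innerSL ℝ) hN1 hN1 p a
  have h2 : (fun p => innerSL ℝ (N p) (N p)) = fun _ => (1 : ℝ) := by
    funext q
    rw [innerSL_apply_apply, real_inner_self_eq_norm_sq, hN.2.1, one_pow]
  rw [h2, diff_const] at h1
  change (0 : ℝ) = ⟪diff N p a, N p⟫_ℝ + ⟪N p, diff N p a⟫_ℝ at h1
  rw [real_inner_comm] at h1
  linarith

/-- The derivative of the unit normal is already tangent, so pulling it back to the model plane and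
pushing it forward again loses nothing. -/
lemma secondForm_eq (hr : IsSmoothImmersion r) (hN : IsUnitNormal r N) (p : M) :
    secondForm r N p = diff r p ∘L weingarten r N p ∘L pullTangent r p := by
  ext1 v
  have h := tanProj_of_inner_eq_zero hr hN (inner_normal_diff hN p (pullTangent r p v))
  rw [tanProj_eq hr] at h
  simp only [secondForm, weingarten, tderiv, ContinuousLinearMap.comp_apply,
    neg_apply, map_neg] at h ⊢
  rw [h]

lemma inner_secondForm_symm (hr : IsSmoothImmersion r) (hN : IsUnitNormal r N) (p : M)
    (v w : Space) : ⟪secondForm r N p v, w⟫_ℝ = ⟪v, secondForm r N p w⟫_ℝ := by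
  have key : ∀ v w : Space, ⟪secondForm r N p v, w⟫_ℝ =
      -⟪diff N p (pullTangent r p v), diff r p (pullTangent r p w)⟫_ℝ := by
    intro v w
    have h := tanProj_of_inner_eq_zero hr hN (inner_normal_diff hN p (pullTangent r p v))
    rw [← ContinuousLinearMap.comp_apply (diff r p), ← tanProj_eq hr, ← inner_tanProj_left, h,
      ← inner_neg_left]
    rfl
  rw [key, real_inner_comm (secondForm r N p w) v, key, inner_diff_normal_symm hr hN]

lemma secondForm_normal (hN : IsUnitNormal r N) (p : M) : secondForm r N p (N p) = 0 := by
  rw [secondForm, neg_apply, tderiv_normal hN, neg_zero]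

lemma meanCurv_eq (hr : IsSmoothImmersion r) (hN : IsUnitNormal r N) (p : M) :
    meanCurv r N p = (1 / 2) * traceSpace (secondForm r N p) := by
  rw [secondForm_eq hr hN, pullTangent_eq, trace_leftInv (hr.2 p)]
  rfl

lemma trace_comp_self_plane (A : Plane →L[ℝ] Plane) :
    tracePlane (A ∘L A) = tracePlane A ^ 2 - 2 * A.det := by
  have h : tracePlane (ContinuousLinearMap.id ℝ Plane) = 2 := by
    rw [tracePlane_coord]; simp; norm_num
  rw [comp_self_plane, map_sub, map_smul, map_smul, h, smul_eq_mul, smul_eq_mul]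
  ring

/-- Writing `K` through traces on the fixed space `ℝ³` gives its smoothness without a frame of the
tangent bundle. -/
lemma gaussCurv_eq (hr : IsSmoothImmersion r) (hN : IsUnitNormal r N) (p : M) :
    gaussCurv r N p = (1 / 2) * (traceSpace (secondForm r N p) ^ 2 -
      traceSpace (secondForm r N p ∘L secondForm r N p)) := by
  have h : secondForm r N p ∘L secondForm r N p =
      diff r p ∘L (weingarten r N p ∘L weingarten r N p) ∘L leftInv (diff r p) := by
    rw [secondForm_eq hr hN, pullTangent_eq]
    ext1 v
    simp [leftInv_apply_self (hr.2 p)]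
  rw [h, trace_leftInv (hr.2 p), trace_comp_self_plane, secondForm_eq hr hN, pullTangent_eq,
    trace_leftInv (hr.2 p), gaussCurv]
  simp only [ContinuousLinearMap.det]
  ring

lemma reg_meanCurv (hr : IsSmoothImmersion r) (hN : IsUnitNormal r N) : Reg ∞ (meanCurv r N) := by
  have h : meanCurv r N = fun p => (1 / 2 : ℝ) • traceSpace (secondForm r N p) :=
    funext fun p => meanCurv_eq hr hN p
  rw [h]
  exact Reg.smul contMDiff_const (Reg.clm traceSpace (reg_secondForm hr hN))

lemma reg_gaussCurv (hr : IsSmoothImmersion r) (hN : IsUnitNormal r N) :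
    Reg ∞ (gaussCurv r N) := by
  have h : gaussCurv r N = fun p => (1 / 2 : ℝ) •
      (traceSpace (secondForm r N p) • traceSpace (secondForm r N p) -
      traceSpace (secondForm r N p ∘L secondForm r N p)) := by
    funext p
    rw [gaussCurv_eq hr hN, sq]; rfl
  have h1 := reg_secondForm hr hN
  have h2 := Reg.clm traceSpace h1
  rw [h]
  exact Reg.smul contMDiff_const ((Reg.smul h2 h2).sub (Reg.clm traceSpace (Reg.clm_comp h1 h1)))

lemma reg_curvatures (hr : IsSmoothImmersion r) (hN : IsUnitNormal r N) :
    Reg ∞ (curvatures r N) :=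
  (reg_meanCurv hr hN).prodMk_space (reg_gaussCurv hr hN)

-- The term from differentiating `f` has rank one, with values in the line of `Y p`. Tangency of `Y
-- p` makes the projection leave it unchanged.
omit [IsManifold (𝓡 2) ∞ M] in
lemma divg_smul (hr : IsSmoothImmersion r) (hN : IsUnitNormal r N) {f : M → ℝ} {Y : M → Space}
    (hf : Reg 1 f) (hY : Reg 1 Y) (p : M) (hYN : ⟪N p, Y p⟫_ℝ = 0) :
    divg r (fun p => f p • Y p) p = f p * divg r Y p + ⟪grad r f p, Y p⟫_ℝ := by
  have h : covDeriv r (fun p => f p • Y p) p =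
      f p • covDeriv r Y p + (tderiv r f p).smulRight (Y p) := by
    ext1 v
    rw [covDeriv, ContinuousLinearMap.comp_apply, tderiv_smul r hf hY, map_add, map_smul, map_smul,
      tanProj_of_inner_eq_zero hr hN hYN, add_comm]
    rfl
  rw [divg, h, map_add, map_smul, traceSpace_smulRight, inner_grad]
  rfl

omit [IsManifold (𝓡 2) ∞ M] in
lemma divg_grad (f : M → ℝ) (p : M) : divg r (grad r f) p = laplacian r f p := rfl

omit [IsManifold (𝓡 2) ∞ M] in
lemma inner_normal_adjTensor (hr : IsSmoothImmersion r) (hN : IsUnitNormal r N)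
    (B : M → Space →L[ℝ] Space) (p : M) : ⟪N p, adjTensor r B p⟫_ℝ = 0 := by
  rw [adjTensor, inner_neg_right, inner_sum, neg_eq_zero]
  exact Finset.sum_eq_zero fun i _ => inner_normal_tanProj hr hN p _

omit [IsManifold (𝓡 2) ∞ M] in
/-- The divergence of `B Y` for a symmetric tangential tensor `B`. -/
lemma divg_clm_apply (hr : IsSmoothImmersion r) (hN : IsUnitNormal r N)
    {B : M → Space →L[ℝ] Space} {Y : M → Space} (hB : Reg 1 B) (hY : Reg 1 Y)
    (hBs : ∀ p v w, ⟪B p v, w⟫_ℝ = ⟪v, B p w⟫_ℝ) (hBN : ∀ p, B p (N p) = 0) (p : M)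
    (hYN : ⟪N p, Y p⟫_ℝ = 0) :
    divg r (fun p => B p (Y p)) p =
      traceSpace (B p ∘L covDeriv r Y p) - ⟪adjTensor r B p, Y p⟫_ℝ := by
  -- The derivative of a family of symmetric operators is symmetric: the identity `hBs` is
  -- differentiated with `v` and `w` constant.
  have hDs : ∀ z v w, ⟪tderiv r B p z v, w⟫_ℝ = ⟪v, tderiv r B p z w⟫_ℝ := by
    intro z v w
    have hc : ∀ v : Space, Reg 1 (fun _ : M => v) := fun v => contMDiff_const
    have h1 := tderiv_inner r (Reg.clm_apply hB (hc v)) (hc w) p z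
    have h2 := tderiv_inner r (hc v) (Reg.clm_apply hB (hc w)) p z
    rw [tderiv_clm_apply r hB (hc v), tderiv_const, tderiv_const] at h1
    rw [tderiv_clm_apply r hB (hc w), tderiv_const, tderiv_const] at h2
    simp only [hBs] at h1
    rw [h1] at h2
    simpa using h2
  have hPB : ∀ v, tanProj r p (B p v) = B p v := fun v => by
    refine tanProj_of_inner_eq_zero hr hN ?_
    rw [← hBs, hBN, inner_zero_left]
  have hBP : ∀ v, B p (tanProj r p v) = B p v := fun v => by
    rw [tanProj_apply hr hN, map_sub, map_smul, hBN, smul_zero, sub_zero]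
  have h1 : covDeriv r (fun p => B p (Y p)) p =
      B p ∘L covDeriv r Y p + tanProj r p ∘L (tderiv r B p).flip (Y p) := by
    ext1 v
    simp only [covDeriv, ContinuousLinearMap.comp_apply, add_apply,
      ContinuousLinearMap.flip_apply]
    rw [tderiv_clm_apply r hB hY, map_add, hPB, hBP, add_comm]
  rw [divg, h1, map_add, sub_eq_add_neg]
  congr 1
  rw [traceSpace_eq_sum, adjTensor, inner_neg_left, neg_neg, sum_inner]
  refine Finset.sum_congr rfl fun i _ => ?_
  simp only [covDerivTensor, ContinuousLinearMap.comp_apply, ContinuousLinearMap.flip_apply]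
  -- Symmetry moves the derivative of `B` from `Y` onto the basis vector, which turns the trace into
  -- the sum that defines `∇* B`.
  rw [inner_tanProj_left, hDs, inner_tanProj_left, tanProj_of_inner_eq_zero hr hN hYN,
    real_inner_comm]

/-- The coefficient `½ F_H + 2 H F_K` of `Δu` in the first variation. -/
def laplaceCoeff (F : ℝ × ℝ → ℝ) (r N : M → Space) (p : M) : ℝ :=
  (1 / 2) * partialH F (curvatures r N p) + 2 * meanCurv r N p * partialK F (curvatures r N p)

/-- The integrand of the first variation, before integration by parts. -/
def firstVariation (F : ℝ × ℝ → ℝ) (r N : M → Space) (u : M → ℝ) (p : M) : ℝ :=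
  partialH F (curvatures r N p) * ((1 / 2) * laplacian r u p
      + (2 * meanCurv r N p ^ 2 - gaussCurv r N p) * u p)
    + partialK F (curvatures r N p) * (2 * meanCurv r N p * laplacian r u p
      - traceSpace (secondForm r N p ∘L hess r u p) + 2 * meanCurv r N p * gaussCurv r N p * u p)
    - 2 * meanCurv r N p * u p * F (curvatures r N p)

/-- The hypothesis `C³` on `F` leaves two derivatives for the partials, as many as the
Euler-Lagrange expression takes. -/
lemma reg_partialH {F : ℝ × ℝ → ℝ} (hF : ContDiff ℝ 3 F) (hr : IsSmoothImmersion r)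
    (hN : IsUnitNormal r N) : Reg 2 (fun p => partialH F (curvatures r N p)) := by
  have h1 : ContDiff ℝ 2 (partialH F) :=
    (hF.fderiv_right (m := 2) two_add_one_eq_three.le).clm_apply contDiff_const
  exact h1.comp_contMDiff ((reg_curvatures hr hN).of_le two_le_infty)

lemma reg_partialK {F : ℝ × ℝ → ℝ} (hF : ContDiff ℝ 3 F) (hr : IsSmoothImmersion r)
    (hN : IsUnitNormal r N) : Reg 2 (fun p => partialK F (curvatures r N p)) := by
  have h1 : ContDiff ℝ 2 (partialK F) :=
    (hF.fderiv_right (m := 2) two_add_one_eq_three.le).clm_apply contDiff_const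
  exact h1.comp_contMDiff ((reg_curvatures hr hN).of_le two_le_infty)

lemma reg_laplaceCoeff {F : ℝ × ℝ → ℝ} (hF : ContDiff ℝ 3 F) (hr : IsSmoothImmersion r)
    (hN : IsUnitNormal r N) : Reg 2 (laplaceCoeff F r N) :=
  (Reg.smul contMDiff_const (reg_partialH hF hr hN)).add
    (Reg.smul (Reg.smul contMDiff_const ((reg_meanCurv hr hN).of_le two_le_infty))
      (reg_partialK hF hr hN))

/-- The second-order terms use up the available regularity and leave class `C⁰`. Continuity makes `u
E` integrable and later upgrades vanishing almost everywhere to vanishing everywhere. -/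
lemma continuous_eulerLagrange {F : ℝ × ℝ → ℝ} (hF : ContDiff ℝ 3 F) (hr : IsSmoothImmersion r)
    (hN : IsUnitNormal r N) : Continuous (eulerLagrange F r N) := by
  have h1 : Continuous (laplacian r (laplaceCoeff F r N)) :=
    (Reg.laplacian (m := 0) hr hN two_le_infty (by rw [zero_add, one_add_one_eq_two])
      (reg_laplaceCoeff hF hr hN)).continuous
  have hB : Reg 2 (fun q => partialK F (curvatures r N q) •
      secondForm r N q) :=
    Reg.smul (reg_partialK hF hr hN) ((reg_secondForm hr hN).of_le two_le_infty)
  have h2 : Continuous (adjSq r _) :=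
    (Reg.adjField (m := 0) (n := 1) hr hN (by simp) (by simp)
      (Reg.adjTensor hr hN two_le_infty one_add_one_eq_two.le hB)).continuous
  have h3 := (reg_partialH hF hr hN).continuous
  have h4 := (reg_partialK hF hr hN).continuous
  have h5 := (reg_meanCurv hr hN).continuous
  have h6 := (reg_gaussCurv hr hN).continuous
  have h7 := hF.continuous.comp (reg_curvatures hr hN).continuous
  have h8 : eulerLagrange F r N = fun p =>
    laplacian r (laplaceCoeff F r N) p
    - adjSq r (fun q => partialK F (curvatures r N q) •
      secondForm r N q) p
    + (2 * meanCurv r N p ^ 2 - gaussCurv r N p) *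
      partialH F (curvatures r N p)
    + 2 * meanCurv r N p * gaussCurv r N p *
      partialK F (curvatures r N p)
    - 2 * meanCurv r N p * (F ∘ curvatures r N) p := rfl
  rw [h8]
  exact (((h1.sub h2).add (((continuous_const.mul (h5.pow 2)).sub h6).mul h3)).add
    (((continuous_const.mul h5).mul h6).mul h4)).sub ((continuous_const.mul h5).mul h7)

variable [MeasurableSpace M] [BorelSpace M] [SecondCountableTopology M] [T2Space M]

/-- The integrations by parts in the first variation. -/
theorem integral_firstVariation {F : ℝ × ℝ → ℝ} (hF : ContDiff ℝ 3 F) (hr : IsSmoothImmersion r)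
    (hN : IsUnitNormal r N) {u : M → ℝ} (hu : Reg ∞ u) (hus : HasCompactSupport u) :
    ∫ p, firstVariation F r N u p ∂(area r) = ∫ p, u p * eulerLagrange F r N p ∂(area r) := by
  set ψ := laplaceCoeff F r N with hψ
  set B : M → Space →L[ℝ] Space := fun q => partialK F (curvatures r N q) • secondForm r N q
    with hB
  have hψr : Reg 2 ψ := reg_laplaceCoeff hF hr hN
  have hBr : Reg 2 B := Reg.smul (reg_partialK hF hr hN) ((reg_secondForm hr hN).of_le two_le_infty)
  have hBs : ∀ p v w, ⟪B p v, w⟫_ℝ = ⟪v, B p w⟫_ℝ := fun p v w => by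
    simp only [hB, smul_apply, inner_smul_left, inner_smul_right, inner_secondForm_symm hr hN]
    rfl
  have hBN : ∀ p, B p (N p) = 0 := fun p => by
    simp only [hB, smul_apply, secondForm_normal hN, smul_zero]
  have h12 : (1 : ℕ∞ω) ≤ 2 := by norm_num
  have h1i : (1 : ℕ∞ω) ≤ ∞ := by simp
  have hu1 : Reg 1 u := hu.of_le h1i
  have hgu : Reg 1 (grad r u) := hu.grad hr le_rfl one_add_one_le_infty
  have hgψ : Reg 1 (grad r ψ) := hψr.grad hr two_le_infty one_add_one_eq_two.le
  have hdB : Reg 1 (adjTensor r B) := Reg.adjTensor hr hN two_le_infty one_add_one_eq_two.le hBr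
  have hnu := inner_normal_grad hN u
  have hnψ := inner_normal_grad hN ψ
  have hndB := inner_normal_adjTensor hr hN B
  have hcont : ∀ {W : M → Space}, Reg 1 W → HasCompactSupport W → Integrable (divg r W) (area r) := by
    intro W hW hs
    have : LocallyCompactSpace M := ChartedSpace.locallyCompactSpace Plane M
    have := isLocallyFiniteMeasure_area hr.1
    exact (continuous_divg hr hN hW).integrable_of_hasCompactSupport
      (HasCompactSupport.intro hs.isCompact fun p hp => divg_eq_zero_of_notMem hp)
  have hgs : ∀ p ∉ tsupport u, grad r u p = 0 := by
    intro p hp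
    rw [grad, tderiv_congr r (notMem_tsupport_iff_eventuallyEq.1 hp)]
    have : tderiv r (0 : M → ℝ) p = 0 := tderiv_const r 0 p
    rw [this, map_zero]
  have hs0 : ∀ p ∉ tsupport u, u p = 0 := fun p hp => image_eq_zero_of_notMem_tsupport hp
  have hsupp : ∀ {W : M → Space}, (∀ p ∉ tsupport u, W p = 0) → HasCompactSupport W :=
    fun h => HasCompactSupport.intro hus.isCompact h
  have hzero : ∀ {W : M → Space}, Reg 1 W → (∀ p, ⟪N p, W p⟫_ℝ = 0) →
      (∀ p ∉ tsupport u, W p = 0) →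
      Integrable (divg r W) (area r) ∧ ∫ p, divg r W p ∂(area r) = 0 := fun hW hWN hWs =>
    ⟨hcont hW (hsupp hWs), integral_divg_eq_zero hr hN hW hWN (hsupp hWs)⟩
  -- The first two fields move the Laplacian from `u` to `ψ`; the last two move the Hessian of `u`
  -- to `(∇*)² B`.
  obtain ⟨i1, e1⟩ := hzero (W := fun p => ψ p • grad r u p) (Reg.smul (hψr.of_le h12) hgu)
    (fun p => by rw [inner_smul_right, hnu, mul_zero]) fun p hp => by rw [hgs p hp, smul_zero]
  obtain ⟨i2, e2⟩ := hzero (W := fun p => u p • grad r ψ p) (Reg.smul hu1 hgψ)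
    (fun p => by rw [inner_smul_right, hnψ, mul_zero]) fun p hp => by rw [hs0 p hp, zero_smul]
  obtain ⟨i3, e3⟩ := hzero (W := fun p => B p (grad r u p)) (Reg.clm_apply (hBr.of_le h12) hgu)
    (fun p => by rw [← hBs, hBN, inner_zero_left]) fun p hp => by rw [hgs p hp, map_zero]
  obtain ⟨i4, e4⟩ := hzero (W := fun p => u p • adjTensor r B p) (Reg.smul hu1 hdB)
    (fun p => by rw [inner_smul_right, hndB, mul_zero]) fun p hp => by rw [hs0 p hp, zero_smul]
  have iE : Integrable (fun p => u p * eulerLagrange F r N p) (area r) := by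
    have : LocallyCompactSpace M := ChartedSpace.locallyCompactSpace Plane M
    have := isLocallyFiniteMeasure_area hr.1
    refine (hu.continuous.mul (continuous_eulerLagrange hF hr hN)).integrable_of_hasCompactSupport
      (HasCompactSupport.intro hus.isCompact fun p hp => ?_)
    change u p * _ = 0
    rw [hs0 p hp, zero_mul]
  -- The first-order terms cancel in pairs: `⟪∇ψ, ∇u⟫` between the first two divergences and `⟪∇* B,
  -- ∇u⟫` between the last two.
  have key : ∀ p, firstVariation F r N u p = u p * eulerLagrange F r N p +
      (divg r (fun p => ψ p • grad r u p) p - divg r (fun p => u p • grad r ψ p) p -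
        divg r (fun p => B p (grad r u p)) p - divg r (fun p => u p • adjTensor r B p) p) := by
    intro p
    rw [divg_smul hr hN (hψr.of_le h12) hgu p (hnu p), divg_smul hr hN hu1 hgψ p (hnψ p),
      divg_clm_apply hr hN (hBr.of_le h12) hgu hBs hBN p (hnu p),
      divg_smul hr hN hu1 hdB p (hndB p), divg_grad, divg_grad,
      real_inner_comm (grad r u p) (grad r ψ p), real_inner_comm (grad r u p) (adjTensor r B p)]
    have h1 : divg r (adjTensor r B) p = -adjSq r B p := by
      rw [adjSq, adjField_eq_neg_divg, neg_neg]
    have h2 : traceSpace (B p ∘L covDeriv r (grad r u) p) =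
        partialK F (curvatures r N p) * traceSpace (secondForm r N p ∘L hess r u p) := by
      rw [← smul_eq_mul, ← map_smul]; rfl
    have h3 : eulerLagrange F r N p = laplacian r ψ p - adjSq r B p
      + (2 * meanCurv r N p ^ 2 - gaussCurv r N p) * partialH F (curvatures r N p)
      + 2 * meanCurv r N p * gaussCurv r N p * partialK F (curvatures r N p)
      - 2 * meanCurv r N p * F (curvatures r N p) := rfl
    have h4 : ψ p = (1 / 2) * partialH F (curvatures r N p) +
      2 * meanCurv r N p * partialK F (curvatures r N p) := rfl
    rw [h1, h2, h3, firstVariation, h4]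
    ring
  simp only [key]
  refine (integral_add iE (((i1.sub i2).sub i3).sub i4)).trans ?_
  rw [integral_sub' ((i1.sub i2).sub i3) i4, integral_sub' (i1.sub i2) i3, integral_sub' i1 i2,
    e1, e2, e3, e4]
  simp

end

/-! ### The normal variation in coordinates -/

/-- A parametrized surface patch `X` with unit normal `n` and a function `u`. -/
structure IsPatch (Ω : Set Plane) (X n : Plane → Space) (u : Plane → ℝ) : Prop where
  isOpen : IsOpen Ω
  contDiffAt_X : ∀ x ∈ Ω, ContDiffAt ℝ ∞ X x
  contDiffAt_n : ∀ x ∈ Ω, ContDiffAt ℝ ∞ n x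
  contDiffAt_u : ∀ x ∈ Ω, ContDiffAt ℝ ∞ u x
  injective : ∀ x ∈ Ω, Function.Injective (fderiv ℝ X x)
  norm_n : ∀ x ∈ Ω, ‖n x‖ = 1
  inner_n : ∀ x ∈ Ω, ∀ v, ⟪n x, fderiv ℝ X x v⟫_ℝ = 0

/-- Evaluation at a vector of space. -/
def evalCLM : Space →L[ℝ] (Space →L[ℝ] Plane) →L[ℝ] Plane := ContinuousLinearMap.apply ℝ Plane

/-- The endomorphism `S` with `⟪S w, v⟫ = ⟪D w v, n⟫`. -/
def pairing (D : Plane →L[ℝ] Plane →L[ℝ] Space) (n : Space) : Plane →L[ℝ] Plane :=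
  evalCLM n ∘L adjointCLM ∘L D

lemma inner_pairing (D : Plane →L[ℝ] Plane →L[ℝ] Space) (n : Space) (w v : Plane) :
    ⟪pairing D n w, v⟫_ℝ = ⟪D w v, n⟫_ℝ := by
  simp [pairing, evalCLM, ContinuousLinearMap.adjoint_inner_left, real_inner_comm]

section Affine

variable {V : Type*} [NormedAddCommGroup V] [NormedSpace ℝ V]

/-- The affine family `f + t g` of functions, at `z = (t, x)`. -/
def affineVar (f g : Plane → V) (z : ℝ × Plane) : V := f z.2 + z.1 • g z.2

lemma affineVar_zero (f g : Plane → V) (x : Plane) : affineVar f g (0, x) = f x := by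
  simp [affineVar]

lemma ContDiffAt.affineVar {k : ℕ∞ω} {f g : Plane → V} {x : Plane} (hf : ContDiffAt ℝ k f x)
    (hg : ContDiffAt ℝ k g x) (t : ℝ) : ContDiffAt ℝ k (affineVar f g) (t, x) :=
  (hf.comp (t, x) contDiffAt_snd).add (contDiffAt_fst.smul (hg.comp (t, x) contDiffAt_snd))

lemma hasDerivAt_affineVar (f g : Plane → V) (x : Plane) (t : ℝ) :
    HasDerivAt (fun t => affineVar f g (t, x)) (g x) t := by
  simpa [affineVar] using ((hasDerivAt_id t).smul_const (g x)).const_add (f x)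

lemma fderiv_affineVar {f g : Plane → V} {x : Plane} (hf : DifferentiableAt ℝ f x)
    (hg : DifferentiableAt ℝ g x) (t : ℝ) :
    fderiv ℝ (fun x => affineVar f g (t, x)) x = affineVar (fderiv ℝ f) (fderiv ℝ g) (t, x) :=
  (hf.hasFDerivAt.add (hg.hasFDerivAt.const_smul t)).fderiv

end Affine

section Variation

variable (X n : Plane → Space) (u : Plane → ℝ)

/-- The differential of `X + t u n` at `x`, where `z = (t, x)`. -/
def varDiff (z : ℝ × Plane) : Plane →L[ℝ] Space :=
  affineVar (fderiv ℝ X) (fderiv ℝ fun y => u y • n y) z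

/-- The second differential of `X + t u n` at `x`, where `z = (t, x)`. -/
def varDiff2 (z : ℝ × Plane) : Plane →L[ℝ] Plane →L[ℝ] Space :=
  affineVar (fderiv ℝ (fderiv ℝ X)) (fderiv ℝ (fderiv ℝ fun y => u y • n y)) z

/-- The projection of `n` to the normal line of `X + t u n` at `x`, where `z = (t, x)`. -/
def varProj (z : ℝ × Plane) : Space :=
  n z.2 - varDiff X n u z (leftInv (varDiff X n u z) (n z.2))

/-- The unit normal of `X + t u n` at `x`, where `z = (t, x)`. -/
def varNormal (z : ℝ × Plane) : Space := ‖varProj X n u z‖⁻¹ • varProj X n u z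

/-- The Weingarten operator of `X + t u n` at `x`, where `z = (t, x)`. -/
def varShape (z : ℝ × Plane) : Plane →L[ℝ] Plane :=
  (gram (varDiff X n u z)).inverse ∘L pairing (varDiff2 X n u z) (varNormal X n u z)

/-- The integrand `F(H, K) dV / dV₀` of `X + t u n` at `x`, where `z = (t, x)`. -/
def varDensity (F : ℝ × ℝ → ℝ) (z : ℝ × Plane) : ℝ :=
  F ((1 / 2) * tracePlane (varShape X n u z), (varShape X n u z).det) *
    √((gram (varDiff X n u z)).det / (gram (fderiv ℝ X z.2)).det)

end Variation

variable {Ω : Set Plane} {X n : Plane → Space} {u : Plane → ℝ}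

namespace IsPatch

variable (h : IsPatch Ω X n u) {x : Plane} (hx : x ∈ Ω)
include h hx

lemma contDiffAt_smul : ContDiffAt ℝ ∞ (fun y => u y • n y) x :=
  (h.contDiffAt_u x hx).smul (h.contDiffAt_n x hx)

omit hx in
lemma fderiv_add_smul (t : ℝ) {y : Plane} (hy : y ∈ Ω) :
    fderiv ℝ (fun y => X y + (t * u y) • n y) y = varDiff X n u (t, y) := by
  have h3 := fderiv_affineVar ((h.contDiffAt_X y hy).differentiableAt (by simp))
    ((h.contDiffAt_smul hy).differentiableAt (by simp)) t
  rw [varDiff, ← h3]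
  congr 1
  funext z
  simp [affineVar, mul_smul]

lemma contDiffAt_varDiff (t : ℝ) : ContDiffAt ℝ ∞ (varDiff X n u) (t, x) :=
  ContDiffAt.affineVar ((h.contDiffAt_X x hx).fderiv_right (m := ∞) le_rfl)
    ((h.contDiffAt_smul hx).fderiv_right (m := ∞) le_rfl) t

lemma contDiffAt_varDiff2 (t : ℝ) : ContDiffAt ℝ ∞ (varDiff2 X n u) (t, x) :=
  ContDiffAt.affineVar
    (((h.contDiffAt_X x hx).fderiv_right (m := ∞) le_rfl).fderiv_right (m := ∞) le_rfl)
    (((h.contDiffAt_smul hx).fderiv_right (m := ∞) le_rfl).fderiv_right (m := ∞) le_rfl) t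

omit h hx in
lemma varDiff_zero : varDiff X n u (0, x) = fderiv ℝ X x :=
  affineVar_zero _ _ x

omit h hx in
lemma varDiff2_zero : varDiff2 X n u (0, x) = fderiv ℝ (fderiv ℝ X) x :=
  affineVar_zero _ _ x

lemma injective_varDiff : Function.Injective (varDiff X n u (0, x)) := by
  rw [varDiff_zero]; exact h.injective x hx

lemma varProj_zero : varProj X n u (0, x) = n x := by
  rw [varProj, varDiff_zero, leftInv_normal (h.inner_n x hx), map_zero, sub_zero]

lemma varNormal_zero : varNormal X n u (0, x) = n x := by
  rw [varNormal, h.varProj_zero hx, h.norm_n x hx, inv_one, one_smul]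

lemma contDiffAt_leftInv_varDiff :
    ContDiffAt ℝ ∞ (fun z => leftInv (varDiff X n u z)) (0, x) :=
  (contDiffAt_leftInv (h.injective_varDiff hx)).comp (0, x) (h.contDiffAt_varDiff hx 0)

lemma contDiffAt_varProj : ContDiffAt ℝ ∞ (varProj X n u) (0, x) := by
  have hn : ContDiffAt ℝ ∞ (fun z : ℝ × Plane => n z.2) (0, x) :=
    (h.contDiffAt_n x hx).comp (0, x) contDiffAt_snd
  exact hn.sub ((h.contDiffAt_varDiff hx 0).clm_apply
    ((h.contDiffAt_leftInv_varDiff hx).clm_apply hn))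

lemma varProj_ne_zero : varProj X n u (0, x) ≠ 0 := by
  rw [h.varProj_zero hx]
  intro h0
  have := h.norm_n x hx
  simp [h0] at this

lemma contDiffAt_varNormal : ContDiffAt ℝ ∞ (varNormal X n u) (0, x) := by
  have h1 := h.contDiffAt_varProj hx
  exact ((h1.norm ℝ (h.varProj_ne_zero hx)).inv (norm_ne_zero_iff.2 (h.varProj_ne_zero hx))).smul h1

/-- The operator is expressed by the inverse Gram operator, the second derivative and the normal,
and not by a derivative of the normal. Joint smoothness in `(t, x)` thus follows factor by factor.
-/
lemma contDiffAt_varShape : ContDiffAt ℝ ∞ (varShape X n u) (0, x) := by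
  have h1 : ContDiffAt ℝ ∞ (fun z => (gram (varDiff X n u z)).inverse) (0, x) :=
    (contDiffAt_inverse_gram (h.injective_varDiff hx)).comp (0, x) (h.contDiffAt_varDiff hx 0)
  refine h1.clm_comp (ContDiffAt.clm_comp ?_ (contDiffAt_const.clm_comp (h.contDiffAt_varDiff2 hx 0)))
  exact ((ContinuousLinearMap.contDiff (F := (Space →L[ℝ] Plane) →L[ℝ] Plane)
    evalCLM).contDiffAt).comp (0, x) (h.contDiffAt_varNormal hx)

lemma eventually_mem : ∀ᶠ z : ℝ × Plane in 𝓝 (0, x), z.2 ∈ Ω :=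
  continuous_snd.continuousAt.eventually (h.isOpen.mem_nhds hx)

lemma eventually_injective :
    ∀ᶠ z in 𝓝 ((0 : ℝ), x), Function.Injective (varDiff X n u z) := by
  have h1 : ContinuousAt (fun z => (gram (varDiff X n u z)).det) (0, x) :=
    ((contDiff_clm_det (n := 0)).continuous.comp
      (contDiff_gram (n := 0)).continuous).continuousAt.comp (h.contDiffAt_varDiff hx 0).continuousAt
  filter_upwards [h1.eventually_ne (det_gram_pos (h.injective_varDiff hx)).ne'] with z hz
  exact injective_of_det_gram_ne_zero hz

lemma eventually_varProj_ne_zero : ∀ᶠ z in 𝓝 ((0 : ℝ), x), varProj X n u z ≠ 0 :=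
  (h.contDiffAt_varProj hx).continuousAt.eventually_ne (h.varProj_ne_zero hx)

lemma eventually_norm_varNormal : ∀ᶠ z in 𝓝 ((0 : ℝ), x), ‖varNormal X n u z‖ = 1 := by
  filter_upwards [h.eventually_varProj_ne_zero hx] with z hz
  rw [varNormal, norm_smul, norm_inv, norm_norm, inv_mul_cancel₀ (norm_ne_zero_iff.2 hz)]

lemma eventually_inner_varNormal :
    ∀ᶠ z in 𝓝 ((0 : ℝ), x), ∀ v, ⟪varNormal X n u z, varDiff X n u z v⟫_ℝ = 0 := by
  filter_upwards [h.eventually_injective hx] with z hz v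
  have h1 : ⟪varProj X n u z, varDiff X n u z v⟫_ℝ = 0 := by
    have h2 := DFunLike.congr_fun (starProjection_range hz) (n z.2)
    rw [varProj, ← ContinuousLinearMap.comp_apply, ← h2]
    exact Submodule.starProjection_inner_eq_zero _ _ ⟨v, rfl⟩
  rw [varNormal, inner_smul_left, h1, mul_zero]

/-- Where the varied differential is injective, its left inverse gives the orthogonal projection
onto the varied tangent plane, so the normal has a formula that is smooth near `t = 0`. -/
lemma eventually_unitNormalNear : ∀ᶠ z in 𝓝 ((0 : ℝ), x),
    unitNormalNear (fun y => X y + (z.1 * u y) • n y) n z.2 = varNormal X n u z := by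
  filter_upwards [h.eventually_injective hx, h.eventually_mem hx] with z hz hzΩ
  have h2 : ∀ (U U' : Submodule ℝ Space), U = U' → Uᗮ.starProjection = U'ᗮ.starProjection := by
    rintro U _ rfl; rfl
  have h3 : tangentPlane (fun y => X y + (z.1 * u y) • n y) z.2 =
      LinearMap.range (varDiff X n u z).toLinearMap := by
    rw [tangentPlane, diff_plane, h.fderiv_add_smul z.1 hzΩ]
  have h4 : (LinearMap.range (varDiff X n u z).toLinearMap)ᗮ.starProjection (n z.2) =
      varProj X n u z := by
    rw [Submodule.starProjection_orthogonal, starProjection_range hz]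
    rfl
  rw [unitNormalNear, h2 _ _ h3, h4, varNormal]

/-- The Weingarten operator of the varied surface. -/
lemma eventually_weingarten : ∀ᶠ z in 𝓝 ((0 : ℝ), x),
    DifferentiableAt ℝ (unitNormalNear (fun y => X y + (z.1 * u y) • n y) n) z.2 ∧
    weingarten (fun y => X y + (z.1 * u y) • n y)
      (unitNormalNear (fun y => X y + (z.1 * u y) • n y) n) z.2 = varShape X n u z := by
  have hN1 : ∀ᶠ z in 𝓝 ((0 : ℝ), x), ContDiffAt ℝ 1 (varNormal X n u) z :=
    ((h.contDiffAt_varNormal hx).of_le (by simp)).eventually (by simp)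
  filter_upwards [h.eventually_injective hx, h.eventually_mem hx, hN1,
    (h.eventually_inner_varNormal hx).eventually_nhds,
    (h.eventually_unitNormalNear hx).eventually_nhds] with z hinj hzΩ hN hperp hunit
  obtain ⟨t, y⟩ := z
  -- The identities hold jointly near `(t, y)`; fixing `t` restricts them to a neighbourhood of `y`,
  -- where they can be differentiated in space.
  have hslice : Filter.Tendsto (fun y' : Plane => (t, y')) (𝓝 y) (𝓝 (t, y)) :=
    (Continuous.prodMk_right t).continuousAt
  have hunit' : unitNormalNear (fun y => X y + (t * u y) • n y) n =ᶠ[𝓝 y]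
      fun y' => varNormal X n u (t, y') := hslice.eventually hunit
  have hΩ : ∀ᶠ y' in 𝓝 y, y' ∈ Ω := h.isOpen.mem_nhds hzΩ
  have hfd : fderiv ℝ (fun y => X y + (t * u y) • n y) =ᶠ[𝓝 y] fun y' => varDiff X n u (t, y') :=
    hΩ.mono fun y' hy' => h.fderiv_add_smul t hy'
  have hNd : DifferentiableAt ℝ (fun y' => varNormal X n u (t, y')) y :=
    (hN.differentiableAt (by simp)).comp y (by fun_prop)
  refine ⟨hNd.congr_of_eventuallyEq hunit', ?_⟩
  have hXt : ContDiffAt ℝ 2 (fun y => X y + (t * u y) • n y) y :=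
    ((h.contDiffAt_X y hzΩ).add ((contDiffAt_const.mul (h.contDiffAt_u y hzΩ)).smul
      (h.contDiffAt_n y hzΩ))).of_le two_le_infty
  have hperp' : ∀ᶠ y' in 𝓝 y, ∀ v, ⟪varNormal X n u (t, y'),
      fderiv ℝ (fun y => X y + (t * u y) • n y) y' v⟫_ℝ = 0 := by
    filter_upwards [hslice.eventually hperp, hfd] with y' h1 h2 v
    rw [h2]; exact h1 v
  have h2 : fderiv ℝ (fderiv ℝ (fun y => X y + (t * u y) • n y)) y = varDiff2 X n u (t, y) := by
    rw [hfd.fderiv_eq]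
    exact fderiv_affineVar (((h.contDiffAt_X y hzΩ).fderiv_right (m := ∞) le_rfl).differentiableAt
      (by simp)) (((h.contDiffAt_smul hzΩ).fderiv_right (m := ∞) le_rfl).differentiableAt
      (by simp)) t
  have key := inner_fderiv_normal hXt hNd hperp'
  change -(leftInv (diff (fun y => X y + (t * u y) • n y) y) ∘L
    diff (unitNormalNear (fun y => X y + (t * u y) • n y) n) y) = _
  rw [diff_plane, diff_plane, hfd.self_of_nhds, hunit'.fderiv_eq, varShape, leftInv]
  rw [h2, hfd.self_of_nhds] at key
  ext1 w
  simp only [neg_apply, ContinuousLinearMap.comp_apply]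
  rw [← map_neg]
  congr 1
  refine ext_inner_right ℝ fun v => ?_
  rw [inner_pairing, inner_neg_left, ContinuousLinearMap.adjoint_inner_left, key, neg_neg,
    real_inner_comm]

end IsPatch

/-! ### The derivative of the variation -/

/-- The tangent plane and `n` span space, so a vector identity may be tested on tangential and
normal components separately. -/
lemma eq_zero_of_inner {G : Plane →L[ℝ] Space} (hG : Function.Injective G) {n : Space}
    (hn : ‖n‖ = 1) (hnG : ∀ v, ⟪n, G v⟫_ℝ = 0) {z : Space} (hz : ∀ v, ⟪z, G v⟫_ℝ = 0)
    (hzn : ⟪z, n⟫_ℝ = 0) : z = 0 := by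
  have h1 := comp_leftInv_apply hG hn hnG z
  have h2 := hz (leftInv G z)
  rw [h1, inner_sub_right, inner_smul_right, hzn, mul_zero, sub_zero] at h2
  exact inner_self_eq_zero.1 h2

namespace IsPatch

variable {Ω : Set Plane} {X n : Plane → Space} {u : Plane → ℝ}
variable (h : IsPatch Ω X n u) {x : Plane} (hx : x ∈ Ω)
include h hx

lemma fderiv_smul_apply (v : Plane) :
    fderiv ℝ (fun y => u y • n y) x v = fderiv ℝ u x v • n x + u x • fderiv ℝ n x v := by
  have h1 := ((h.contDiffAt_u x hx).differentiableAt (by simp)).hasFDerivAt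
  have h2 := ((h.contDiffAt_n x hx).differentiableAt (by simp)).hasFDerivAt
  rw [show fderiv ℝ (fun y => u y • n y) x = _ from (h1.smul h2).fderiv]
  simp [add_comm]

lemma inner_fderiv_n (v : Plane) : ⟪fderiv ℝ n x v, n x⟫_ℝ = 0 := by
  have h2 := ((h.contDiffAt_n x hx).differentiableAt (by simp)).hasFDerivAt
  have h3 : (fun y => ⟪n y, n y⟫_ℝ) =ᶠ[𝓝 x] fun _ => 1 := by
    filter_upwards [h.isOpen.mem_nhds hx] with y hy
    rw [real_inner_self_eq_norm_sq, h.norm_n y hy, one_pow]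
  have h4 := DFunLike.congr_fun ((h2.inner ℝ h2).unique
    ((hasFDerivAt_const (1 : ℝ) x).congr_of_eventuallyEq h3)) v
  have h5 : ⟪n x, fderiv ℝ n x v⟫_ℝ + ⟪fderiv ℝ n x v, n x⟫_ℝ = 0 := by simpa using h4
  rw [real_inner_comm] at h5
  linarith

lemma inner_fderiv_smul (v : Plane) :
    ⟪fderiv ℝ (fun y => u y • n y) x v, n x⟫_ℝ = fderiv ℝ u x v := by
  rw [h.fderiv_smul_apply hx, inner_add_left, inner_smul_left, inner_smul_left,
    h.inner_fderiv_n hx, real_inner_self_eq_norm_sq, h.norm_n x hx]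
  simp

lemma inner_varShape (w v : Plane) :
    ⟪fderiv ℝ X x (varShape X n u (0, x) w), fderiv ℝ X x v⟫_ℝ =
      ⟪fderiv ℝ (fderiv ℝ X) x w v, n x⟫_ℝ := by
  rw [← inner_gram, varShape, varDiff_zero, ContinuousLinearMap.comp_apply,
    (gram_isInvertible (h.injective x hx)).self_apply_inverse, inner_pairing, varDiff2_zero,
    h.varNormal_zero hx]

/-- The Weingarten equation at `t = 0`. Neither side has a normal component, and the tangential
components agree by differentiating `⟪n, dX v⟫ = 0`. -/
lemma fderiv_varShape (w : Plane) :
    fderiv ℝ X x (varShape X n u (0, x) w) = -fderiv ℝ n x w := by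
  rw [← add_eq_zero_iff_eq_neg]
  refine eq_zero_of_inner (h.injective x hx) (h.norm_n x hx) (h.inner_n x hx) (fun v => ?_) ?_
  · rw [inner_add_left, h.inner_varShape hx, inner_fderiv_normal
      ((h.contDiffAt_X x hx).of_le two_le_infty)
      ((h.contDiffAt_n x hx).differentiableAt (by simp))
      (Filter.eventually_of_mem (h.isOpen.mem_nhds hx) h.inner_n), real_inner_comm]
    ring
  · rw [inner_add_left, h.inner_fderiv_n hx, real_inner_comm, h.inner_n x hx, add_zero]

omit h hx in
lemma hasDerivAt_slice {V : Type*} [NormedAddCommGroup V] [NormedSpace ℝ V] {f : ℝ × Plane → V}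
    (hf : ContDiffAt ℝ ∞ f (0, x)) :
    HasDerivAt (fun t => f (t, x)) (deriv (fun t => f (t, x)) 0) 0 := by
  refine DifferentiableAt.hasDerivAt ?_
  exact (hf.differentiableAt (by simp)).comp (0 : ℝ) (f := fun t : ℝ => (t, x)) (by fun_prop)

omit h hx in
lemma eventually_slice {P : ℝ × Plane → Prop} (hP : ∀ᶠ z in 𝓝 ((0 : ℝ), x), P z) :
    ∀ᶠ t in 𝓝 (0 : ℝ), P (t, x) :=
  (Continuous.prodMk_left x).continuousAt.eventually hP

omit h hx in
lemma hasDerivAt_varDiff : HasDerivAt (fun t => varDiff X n u (t, x))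
    (fderiv ℝ (fun y => u y • n y) x) 0 :=
  hasDerivAt_affineVar _ _ x 0

omit h hx in
lemma hasDerivAt_varDiff2 : HasDerivAt (fun t => varDiff2 X n u (t, x))
    (fderiv ℝ (fderiv ℝ fun y => u y • n y) x) 0 :=
  hasDerivAt_affineVar _ _ x 0

variable {g : Plane → Space} (hgn : ⟪g x, n x⟫_ℝ = 0)
  (hgX : ∀ᶠ y in 𝓝 x, ∀ v, ⟪g y, fderiv ℝ X y v⟫_ℝ = fderiv ℝ u y v)
include hgn hgX

/-- The unit normal turns by minus the gradient of `u`. -/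
lemma hasDerivAt_varNormal : HasDerivAt (fun t => varNormal X n u (t, x)) (-g x) 0 := by
  have h1 := hasDerivAt_slice (h.contDiffAt_varNormal hx)
  set N' := deriv (fun t => varNormal X n u (t, x)) 0 with hN'
  suffices hs : N' + g x = 0 by
    rwa [eq_neg_of_add_eq_zero_left hs] at h1
  refine eq_zero_of_inner (h.injective x hx) (h.norm_n x hx) (h.inner_n x hx) (fun v => ?_) ?_
  -- Tangential component: differentiating orthogonality in `t` gives `⟪n', dX v⟫ = -⟪n, d(u n) v⟫ =
  -- -du(v)`.
  · have h2 := (h1.inner ℝ ((hasDerivAt_varDiff (X := X) (n := n) (u := u) (x := x)).clm_apply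
      (hasDerivAt_const (0 : ℝ) v))).unique ((hasDerivAt_const (0 : ℝ) (0 : ℝ)).congr_of_eventuallyEq
      ((eventually_slice (h.eventually_inner_varNormal hx)).mono fun t ht => ht v))
    simp only [h.varNormal_zero hx, varDiff_zero, map_zero, add_zero] at h2
    rw [real_inner_comm, h.inner_fderiv_smul hx] at h2
    rw [inner_add_left, hgX.self_of_nhds v]
    linarith
  -- Normal component: differentiating `|n_t|² = 1` in `t`.
  · have h2 := (h1.inner ℝ h1).unique ((hasDerivAt_const (0 : ℝ) (1 : ℝ)).congr_of_eventuallyEq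
      ((eventually_slice (h.eventually_norm_varNormal hx)).mono fun t ht => by
        simp only [real_inner_self_eq_norm_sq, ht, one_pow]))
    simp only [h.varNormal_zero hx] at h2
    rw [real_inner_comm] at h2
    rw [inner_add_left, hgn]
    linarith

/-- The Weingarten operator changes by `Hess u + u A²`. -/
lemma hasDerivAt_varShape (hg : DifferentiableAt ℝ g x) :
    HasDerivAt (fun t => varShape X n u (t, x))
      (leftInv (fderiv ℝ X x) ∘L fderiv ℝ g x +
        u x • (varShape X n u (0, x) ∘L varShape X n u (0, x))) 0 := by
  have h1 := hasDerivAt_slice (h.contDiffAt_varShape hx)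
  have hN := h.hasDerivAt_varNormal hx hgn hgX
  set A' := deriv (fun t => varShape X n u (t, x)) 0 with hA'
  set A := varShape X n u (0, x) with hA
  set G := fderiv ℝ X x with hG
  have hinj := h.injective x hx
  suffices hs : A' = leftInv G ∘L fderiv ℝ g x + u x • (A ∘L A) by rwa [hs] at h1
  have hud : DifferentiableAt ℝ (fderiv ℝ u) x :=
    ((h.contDiffAt_u x hx).fderiv_right (m := ∞) le_rfl).differentiableAt (by simp)
  have hXd : DifferentiableAt ℝ (fderiv ℝ X) x :=
    ((h.contDiffAt_X x hx).fderiv_right (m := ∞) le_rfl).differentiableAt (by simp)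
  have hYd : DifferentiableAt ℝ (fderiv ℝ fun y => u y • n y) x :=
    ((h.contDiffAt_smul hx).fderiv_right (m := ∞) le_rfl).differentiableAt (by simp)
  have hnd : DifferentiableAt ℝ n x := (h.contDiffAt_n x hx).differentiableAt (by simp)
  have key : ∀ w v, ⟪G (A' w), G v⟫_ℝ =
      ⟪fderiv ℝ g x w, G v⟫_ℝ + u x * ⟪G (A (A w)), G v⟫_ℝ := by
    intro w v
    -- Clearing the inverse Gram operator first makes the `t`-derivative a plain product rule on
    -- inner products.
    have e1 : (fun t => ⟪varDiff X n u (t, x) (varShape X n u (t, x) w), varDiff X n u (t, x) v⟫_ℝ)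
        =ᶠ[𝓝 (0 : ℝ)] fun t => ⟪varDiff2 X n u (t, x) w v, varNormal X n u (t, x)⟫_ℝ := by
      filter_upwards [eventually_slice (h.eventually_injective hx)] with t ht
      rw [← inner_gram, varShape, ContinuousLinearMap.comp_apply,
        (gram_isInvertible ht).self_apply_inverse, inner_pairing]
    have dG := hasDerivAt_varDiff (X := X) (n := n) (u := u) (x := x)
    have dD := hasDerivAt_varDiff2 (X := X) (n := n) (u := u) (x := x)
    have c := fun v : Plane => hasDerivAt_const (0 : ℝ) v
    have d1 := (dG.clm_apply (h1.clm_apply (c w))).inner ℝ (dG.clm_apply (c v))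
    have d2 := ((dD.clm_apply (c w)).clm_apply (c v)).inner ℝ hN
    have e2 := d1.unique (d2.congr_of_eventuallyEq e1)
    simp only [h.varNormal_zero hx, varDiff_zero, varDiff2_zero, map_zero, add_zero]
      at e2
    have e3 : ⟪G (A w), fderiv ℝ (fun y => u y • n y) x v⟫_ℝ =
        -(u x * ⟪fderiv ℝ n x w, fderiv ℝ n x v⟫_ℝ) := by
      rw [h.fderiv_varShape hx, h.fderiv_smul_apply hx, inner_neg_left, inner_add_right,
        inner_smul_right, inner_smul_right, h.inner_fderiv_n hx]
      ring
    have e4 : ⟪fderiv ℝ (fun y => u y • n y) x (A w), G v⟫_ℝ = -(u x * ⟪G (A (A w)), G v⟫_ℝ) := by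
      rw [h.fderiv_smul_apply hx, h.fderiv_varShape hx (A w), inner_add_left, inner_smul_left,
        inner_smul_left, h.inner_n x hx, inner_neg_left]
      simp
    -- Obtained by differentiating `⟪d(u n) v, n⟫ = du(v)` in space.
    have e5 : ⟪fderiv ℝ (fderiv ℝ fun y => u y • n y) x w v, n x⟫_ℝ =
        fderiv ℝ (fderiv ℝ u) x w v - u x * ⟪fderiv ℝ n x w, fderiv ℝ n x v⟫_ℝ := by
      have f1 := (hYd.hasFDerivAt.clm_apply (hasFDerivAt_const v x)).inner ℝ hnd.hasFDerivAt
      have f2 : HasFDerivAt (fun y => fderiv ℝ u y v) _ x :=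
        hud.hasFDerivAt.clm_apply (hasFDerivAt_const v x)
      have f3 : (fun y => ⟪fderiv ℝ (fun y => u y • n y) y v, n y⟫_ℝ) =ᶠ[𝓝 x]
          fun y => fderiv ℝ u y v := by
        filter_upwards [h.isOpen.mem_nhds hx] with y hy using h.inner_fderiv_smul hy v
      have f4 := DFunLike.congr_fun (f1.unique (f2.congr_of_eventuallyEq f3)) w
      simp at f4
      rw [h.fderiv_smul_apply hx, inner_add_left, inner_smul_left, inner_smul_left,
        real_inner_comm (fderiv ℝ n x w) (n x), h.inner_fderiv_n hx,
        real_inner_comm (fderiv ℝ n x w) (fderiv ℝ n x v)] at f4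
      simp at f4
      linarith
    -- Obtained by differentiating `⟪g, dX v⟫ = du(v)` in space. The coordinate Hessian `D²u`
    -- cancels against the one in `e5` and leaves the covariant term `⟪dg w, dX v⟫`.
    have e6 : ⟪fderiv ℝ (fderiv ℝ X) x w v, g x⟫_ℝ =
        fderiv ℝ (fderiv ℝ u) x w v - ⟪fderiv ℝ g x w, G v⟫_ℝ := by
      have f1 := hg.hasFDerivAt.inner ℝ (hXd.hasFDerivAt.clm_apply (hasFDerivAt_const v x))
      have f2 : HasFDerivAt (fun y => fderiv ℝ u y v) _ x :=
        hud.hasFDerivAt.clm_apply (hasFDerivAt_const v x)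
      have f4 := DFunLike.congr_fun (f1.unique (f2.congr_of_eventuallyEq
        (hgX.mono fun y hy => hy v))) w
      simp at f4
      rw [real_inner_comm] at f4
      linarith
    rw [← hA, ← hG, e3, inner_add_left, e4, inner_neg_right, e5, e6] at e2
    linarith
  ext1 w
  refine (gram_isInvertible hinj).injective (ext_inner_right ℝ fun v => ?_)
  rw [inner_gram, key, inner_gram]
  simp only [add_apply, smul_apply, ContinuousLinearMap.comp_apply, map_add, map_smul,
    inner_add_left, inner_smul_left]
  congr 1
  rw [← inner_gram, ← ContinuousLinearMap.comp_apply (gram _), gram_leftInv hinj,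
    ContinuousLinearMap.adjoint_inner_left]

end IsPatch

lemma fderiv_eq_partial (F : ℝ × ℝ → ℝ) (z : ℝ × ℝ) (a b : ℝ) :
    fderiv ℝ F z (a, b) = partialH F z * a + partialK F z * b := by
  have : (a, b) = a • ((1 : ℝ), (0 : ℝ)) + b • ((0 : ℝ), (1 : ℝ)) := by simp
  rw [this, map_add, map_smul, map_smul, partialH, partialK, smul_eq_mul, smul_eq_mul]
  ring

/-- In the variation of the determinant, `u A²` contributes `tr A · tr A² - tr A³`; this evaluates
it to `2 H K`. -/
lemma trace_comp_comp_self_plane (A : Plane →L[ℝ] Plane) :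
    tracePlane (A ∘L (A ∘L A)) = tracePlane A ^ 3 - 3 * A.det * tracePlane A := by
  have h : A ∘L (A ∘L A) = tracePlane A • (A ∘L A) - A.det • A := by
    conv_lhs => rw [comp_self_plane A]
    ext1 v
    simp
  rw [h, map_sub, map_smul, map_smul, trace_comp_self_plane, smul_eq_mul, smul_eq_mul]
  ring

namespace IsPatch

variable {Ω : Set Plane} {X n : Plane → Space} {u : Plane → ℝ}
variable (h : IsPatch Ω X n u) {x : Plane} (hx : x ∈ Ω)
include h hx

/-- Joint regularity in `(t, x)` is what later bounds the `t`-derivative locally uniformly. -/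
lemma contDiffAt_varDensity {F : ℝ × ℝ → ℝ} (hF : ContDiff ℝ 3 F) :
    ContDiffAt ℝ 1 (varDensity X n u F) (0, x) := by
  have hA : ContDiffAt ℝ 1 (varShape X n u) (0, x) := (h.contDiffAt_varShape hx).of_le (by simp)
  have h1 : ContDiffAt ℝ 1 (fun z => ((1 / 2) * tracePlane (varShape X n u z),
      (varShape X n u z).det)) (0, x) :=
    (contDiffAt_const.mul (tracePlane.contDiff.contDiffAt.comp (0, x) hA)).prodMk
      (contDiff_clm_det.contDiffAt.comp (0, x) hA)
  have hdet : ∀ {f : ℝ × Plane → Plane →L[ℝ] Space}, ContDiffAt ℝ ∞ f (0, x) →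
      ContDiffAt ℝ 1 (fun z => (gram (f z)).det) (0, x) := fun hf =>
    (contDiff_clm_det.comp contDiff_gram).contDiffAt.comp (0, x) (hf.of_le (by simp))
  have hpos := det_gram_pos (h.injective x hx)
  have h0 := hdet (f := fun z => fderiv ℝ X z.2)
    (((h.contDiffAt_X x hx).fderiv_right (m := ∞) le_rfl).comp (0, x) contDiffAt_snd)
  have h2 := ((hdet (h.contDiffAt_varDiff hx 0)).div h0 hpos.ne').sqrt (by
    change (gram (varDiff X n u (0, x))).det / (gram (fderiv ℝ X x)).det ≠ 0
    rw [varDiff_zero, div_self hpos.ne']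
    exact one_ne_zero)
  exact ((hF.of_le (by norm_num)).contDiffAt.comp (0, x) h1).mul h2

/-- The first variation of the integrand. -/
lemma hasDerivAt_varDensity {F : ℝ × ℝ → ℝ} (hF : ContDiff ℝ 3 F) {g : Plane → Space}
    (hgn : ⟪g x, n x⟫_ℝ = 0)
    (hgX : ∀ᶠ y in 𝓝 x, ∀ v, ⟪g y, fderiv ℝ X y v⟫_ℝ = fderiv ℝ u y v)
    (hg : DifferentiableAt ℝ g x) {H K l m : ℝ}
    (hH : H = (1 / 2) * tracePlane (varShape X n u (0, x))) (hK : K = (varShape X n u (0, x)).det)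
    (hl : l = tracePlane (leftInv (fderiv ℝ X x) ∘L fderiv ℝ g x))
    (hm : m = tracePlane (varShape X n u (0, x) ∘L leftInv (fderiv ℝ X x) ∘L fderiv ℝ g x)) :
    HasDerivAt (fun t => varDensity X n u F (t, x))
      (partialH F (H, K) * ((1 / 2) * l + (2 * H ^ 2 - K) * u x)
        + partialK F (H, K) * (2 * H * l - m + 2 * H * K * u x)
        - 2 * H * u x * F (H, K)) 0 := by
  have hA := h.hasDerivAt_varShape hx hgn hgX hg
  set A := varShape X n u (0, x) with hA0
  set L := leftInv (fderiv ℝ X x) ∘L fderiv ℝ g x with hL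
  have htr : tracePlane A = 2 * H := by rw [hH]; ring
  -- The zeroth-order coefficient is `½ tr A² = 2H² - K`.
  have d1 : HasDerivAt (fun t => (1 / 2) * tracePlane (varShape X n u (t, x)))
      ((1 / 2) * l + (2 * H ^ 2 - K) * u x) 0 := by
    have := (tracePlane.hasFDerivAt.comp_hasDerivAt (0 : ℝ) hA).const_mul (1 / 2)
    refine this.congr_deriv ?_
    rw [map_add, map_smul, trace_comp_self_plane, htr, ← hl, ← hK, smul_eq_mul]
    ring
  have d2 : HasDerivAt (fun t => (varShape X n u (t, x)).det)
      (2 * H * l - m + 2 * H * K * u x) 0 := by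
    have := (hasFDerivAt_clm_det A).comp_hasDerivAt (0 : ℝ) hA
    refine this.congr_deriv ?_
    simp only [sub_apply, smul_apply, ContinuousLinearMap.comp_apply,
      ContinuousLinearMap.compL_apply, smul_eq_mul]
    rw [ContinuousLinearMap.comp_add A, ContinuousLinearMap.comp_smul, map_add, map_add, map_smul,
      map_smul, trace_comp_self_plane, trace_comp_comp_self_plane, htr, ← hl, ← hm, ← hK,
      smul_eq_mul, smul_eq_mul]
    ring
  have hinj := h.injective x hx
  have hpos := det_gram_pos hinj
  -- Only the tangential part `u dn = -u dX ∘ A` of `d(u n)` affects the area to first order, at the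
  -- rate `-u tr A`.
  have d3 : HasDerivAt (fun t => √((gram (varDiff X n u (t, x))).det /
      (gram (fderiv ℝ X x)).det)) (-(2 * H * u x)) 0 := by
    have e1 := hasFDerivAt_sqrt_det_gram hinj
    rw [← varDiff_zero (X := X) (n := n) (u := u) (x := x)] at e1
    have e2 := (e1.comp_hasDerivAt (0 : ℝ)
      (hasDerivAt_varDiff (X := X) (n := n) (u := u) (x := x))).div_const
        (√(gram (fderiv ℝ X x)).det)
    rw [varDiff_zero] at e2
    have e3 : leftInv (fderiv ℝ X x) ∘L fderiv ℝ (fun y => u y • n y) x = -(u x • A) := by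
      ext1 v
      have := h.fderiv_varShape hx v
      rw [ContinuousLinearMap.comp_apply, h.fderiv_smul_apply hx, map_add, map_smul,
        leftInv_normal (h.inner_n x hx), map_smul, ← neg_neg (fderiv ℝ n x v), ← this, map_neg,
        leftInv_apply_self hinj]
      simp [hA0]
    refine (e2.congr_deriv ?_).congr_of_eventuallyEq (Filter.Eventually.of_forall fun t => ?_)
    · simp only [smul_apply, ContinuousLinearMap.comp_apply, ContinuousLinearMap.compL_apply]
      rw [e3, map_neg, map_smul, htr, smul_eq_mul, smul_eq_mul,
        mul_div_cancel_left₀ _ (Real.sqrt_pos.2 hpos).ne']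
      ring
    · exact Real.sqrt_div (det_gram_nonneg _) _
  have hFd : HasFDerivAt F (fderiv ℝ F (H, K)) ((1 / 2) * tracePlane A, A.det) := by
    rw [← hH, ← hK]
    exact (hF.contDiffAt.differentiableAt (by simp)).hasFDerivAt
  have d4 := (hFd.comp_hasDerivAt (0 : ℝ) (d1.prodMk d2)).mul d3
  refine d4.congr_deriv ?_
  simp only [Function.comp_apply]
  rw [fderiv_eq_partial, varDiff_zero, div_self hpos.ne', Real.sqrt_one, ← hA0, ← hH, ← hK]
  ring

end IsPatch

/-! ### The variation on the surface, read in charts -/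

section Varied

variable {M : Type*} [TopologicalSpace M] [ChartedSpace Plane M] [IsManifold (𝓡 2) ∞ M]
  {r N : M → Space} {u : M → ℝ}

lemma isPatch_chart (hr : IsSmoothImmersion r) (hN : IsUnitNormal r N) (hu : Reg ∞ u) (c : M) :
    IsPatch (chartAt Plane c).target (r ∘ (chartAt Plane c).symm) (N ∘ (chartAt Plane c).symm)
      (u ∘ (chartAt Plane c).symm) where
  isOpen := (chartAt Plane c).open_target
  contDiffAt_X _ hx := contDiffAt_comp_chart hr.1 c hx
  contDiffAt_n _ hx := contDiffAt_comp_chart hN.1 c hx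
  contDiffAt_u _ hx := contDiffAt_comp_chart hu c hx
  injective _ hx := injective_fderiv_chart hr c hx
  norm_n _ _ := hN.2.1 _
  inner_n x hx v := by
    rw [fderiv_comp_chart c hx ((hr.1 _).mdifferentiableAt (by simp))]
    exact hN.2.2 _ _

lemma reg_normalVariation (hr : IsSmoothImmersion r) (hN : IsUnitNormal r N) (hu : Reg ∞ u)
    (t : ℝ) : Reg ∞ (normalVariation r N u t) :=
  hr.1.add (Reg.smul (Reg.smul contMDiff_const hu) hN.1)

/-- Used for the varied unit normal, whose differentiability is known from its coordinate formula
only. -/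
lemma mdifferentiableAt_of_chart {V : Type*} [NormedAddCommGroup V] [NormedSpace ℝ V] {f : M → V}
    (c : M) {x : Plane} (hx : x ∈ (chartAt Plane c).target)
    (hf : DifferentiableAt ℝ (f ∘ (chartAt Plane c).symm) x) :
    MDifferentiableAt (𝓡 2) 𝓘(ℝ, V) f ((chartAt Plane c).symm x) := by
  have : IsManifold (𝓡 2) 1 M := IsManifold.of_le (n := ∞) (by simp)
  have hs := (chartAt Plane c).map_target hx
  have h1 := (mdifferentiable_chart (I := 𝓡 2) c).mdifferentiableAt hs
  have h2 : MDifferentiableAt 𝓘(ℝ, Plane) 𝓘(ℝ, V) (f ∘ (chartAt Plane c).symm)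
      (chartAt Plane c ((chartAt Plane c).symm x)) := by
    rw [(chartAt Plane c).right_inv hx]
    exact hf.mdifferentiableAt
  refine (h2.comp _ h1).congr_of_eventuallyEq ?_
  filter_upwards [(chartAt Plane c).open_source.mem_nhds hs] with q hq
  simp [(chartAt Plane c).left_inv hq]

/-- The integrand of the varied functional with respect to the area of `r`. -/
def variedIntegrand (F : ℝ × ℝ → ℝ) (r N : M → Space) (u : M → ℝ) (t : ℝ) (p : M) : ℝ :=
  F (curvatures (normalVariation r N u t) (unitNormalNear (normalVariation r N u t) N) p) *
    areaRatio r (normalVariation r N u t) p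

/-- The equality holds on a neighbourhood in both variables, so it transfers the derivative in `t`
as well as the joint `C¹` regularity. -/
lemma variedIntegrand_chart (F : ℝ × ℝ → ℝ) (hr : IsSmoothImmersion r) (hN : IsUnitNormal r N)
    (hu : Reg ∞ u) (c : M) {x : Plane} (hx : x ∈ (chartAt Plane c).target) :
    ∀ᶠ z in 𝓝 ((0 : ℝ), x), variedIntegrand F r N u z.1 ((chartAt Plane c).symm z.2) =
      varDensity (r ∘ (chartAt Plane c).symm) (N ∘ (chartAt Plane c).symm)
        (u ∘ (chartAt Plane c).symm) F z := by
  set e := chartAt Plane c with he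
  have h := isPatch_chart hr hN hu c
  filter_upwards [h.eventually_mem hx, h.eventually_weingarten hx] with z hz hw
  have hr' := reg_normalVariation hr hN hu z.1
  have hrd : ∀ q, MDifferentiableAt (𝓡 2) 𝓘(ℝ, Space) (normalVariation r N u z.1) q :=
    fun q => (hr' q).mdifferentiableAt (by simp)
  have hcomp : normalVariation r N u z.1 ∘ e.symm =
    fun y => (r ∘ e.symm) y + (z.1 * (u ∘ e.symm) y) • (N ∘ e.symm) y := rfl
  have hn : unitNormalNear (normalVariation r N u z.1) N ∘ e.symm =ᶠ[𝓝 z.2]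
      unitNormalNear (normalVariation r N u z.1 ∘ e.symm) (N ∘ e.symm) := by
    filter_upwards [mem_nhds_chart_target c hz] with y hy
    exact (unitNormalNear_chart c hy N (hrd _)).symm
  have hnd : MDifferentiableAt (𝓡 2) 𝓘(ℝ, Space) (unitNormalNear (normalVariation r N u z.1) N)
      (e.symm z.2) := mdifferentiableAt_of_chart c hz (hw.1.congr_of_eventuallyEq hn)
  have hW : weingarten (normalVariation r N u z.1 ∘ e.symm)
      (unitNormalNear (normalVariation r N u z.1) N ∘ e.symm) z.2 =
      varShape (r ∘ e.symm) (N ∘ e.symm) (u ∘ e.symm) z := by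
    rw [← hw.2, weingarten, weingarten, diff_congr hn]
    rfl
  rw [variedIntegrand, varDensity, curvatures, meanCurv_chart c hz (hrd _) hnd,
    gaussCurv_chart c hz (hrd _) hnd, meanCurv, gaussCurv, hW,
    areaRatio_chart c hz ((hr.1 _).mdifferentiableAt (by simp)) (hrd _), hcomp,
    h.fderiv_add_smul z.1 hz]
  rfl

lemma weingarten_eq_varShape (hr : IsSmoothImmersion r) (hN : IsUnitNormal r N)
    (hu : Reg ∞ u) (c : M) {x : Plane} (hx : x ∈ (chartAt Plane c).target) :
    weingarten (r ∘ (chartAt Plane c).symm) (N ∘ (chartAt Plane c).symm) x =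
      varShape (r ∘ (chartAt Plane c).symm) (N ∘ (chartAt Plane c).symm)
        (u ∘ (chartAt Plane c).symm) (0, x) := by
  have h := isPatch_chart hr hN hu c
  ext1 v
  rw [← leftInv_apply_self (h.injective x hx) (varShape _ _ _ (0, x) v), h.fderiv_varShape hx,
    weingarten, diff_plane, map_neg, pullTangent_eq, diff_plane]
  rfl

/-- The pointwise first variation. -/
lemma hasDerivAt_variedIntegrand {F : ℝ × ℝ → ℝ} (hF : ContDiff ℝ 3 F) (hr : IsSmoothImmersion r)
    (hN : IsUnitNormal r N) (hu : Reg ∞ u) (p : M) :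
    HasDerivAt (fun t => variedIntegrand F r N u t p) (firstVariation F r N u p) 0 := by
  have key : ∀ (c : M) (x : Plane), x ∈ (chartAt Plane c).target →
      HasDerivAt (fun t => variedIntegrand F r N u t ((chartAt Plane c).symm x))
        (firstVariation F r N u ((chartAt Plane c).symm x)) 0 := by
    intro c x hx
    set e := chartAt Plane c with he
    have h := isPatch_chart hr hN hu c
    have hinj := h.injective x hx
    have hrd : ∀ q, MDifferentiableAt (𝓡 2) 𝓘(ℝ, Space) r q :=
      fun q => (hr.1 q).mdifferentiableAt (by simp)
    have hNd : ∀ q, MDifferentiableAt (𝓡 2) 𝓘(ℝ, Space) N q :=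
      fun q => (hN.1 q).mdifferentiableAt (by simp)
    have hgu : Reg 1 (grad r u) := hu.grad hr le_rfl one_add_one_le_infty
    -- The abstract field `g` of the patch computation is taken to be the gradient of `u`, so that
    -- the trace of its covariant derivative is the Laplacian.
    have hgX : ∀ᶠ y in 𝓝 x, ∀ v, ⟪(grad r u ∘ e.symm) y, fderiv ℝ (r ∘ e.symm) y v⟫_ℝ =
        fderiv ℝ (u ∘ e.symm) y v := by
      filter_upwards [mem_nhds_chart_target c hx] with y hy v
      rw [Function.comp_apply, inner_grad,
        tderiv_chart c hy (hrd _) ((hu _).mdifferentiableAt (by simp)),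
        ContinuousLinearMap.comp_apply, leftInv_apply_self (h.injective y hy)]
    have hgn : ⟪(grad r u ∘ e.symm) x, (N ∘ e.symm) x⟫_ℝ = 0 := by
      rw [real_inner_comm]; exact inner_normal_grad hN u _
    have hgd : DifferentiableAt ℝ (grad r u ∘ e.symm) x :=
      ((contMDiffAt_iff_chart (by simp) c hx).1 (hgu _)).differentiableAt (by simp)
    have hA := weingarten_eq_varShape hr hN hu c hx
    have hH : meanCurv r N (e.symm x) = (1 / 2) * tracePlane (varShape (r ∘ e.symm) (N ∘ e.symm)
        (u ∘ e.symm) (0, x)) := by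
      rw [meanCurv_chart c hx (hrd _) (hNd _), meanCurv, hA]; rfl
    have hK : gaussCurv r N (e.symm x) = (varShape (r ∘ e.symm) (N ∘ e.symm)
        (u ∘ e.symm) (0, x)).det := by
      rw [gaussCurv_chart c hx (hrd _) (hNd _), gaussCurv, hA]
    have hl : laplacian r u (e.symm x) = _ := divg_chart hr hgu c hx
    have hm : traceSpace (secondForm r N (e.symm x) ∘L hess r u (e.symm x)) =
        tracePlane (varShape (r ∘ e.symm) (N ∘ e.symm) (u ∘ e.symm) (0, x) ∘L
          leftInv (fderiv ℝ (r ∘ e.symm) x) ∘L fderiv ℝ (grad r u ∘ e.symm) x) := by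
      rw [← trace_leftInv hinj, hess, covDeriv_chart hr hgu c hx, secondForm,
        tderiv_chart c hx (hrd _) (hNd _)]
      congr 1
      ext1 v
      simp only [ContinuousLinearMap.comp_apply, neg_apply, leftInv_apply_self hinj]
      exact (h.fderiv_varShape hx _).symm
    have h2 := h.hasDerivAt_varDensity hx hF hgn hgX hgd hH hK hl hm
    exact h2.congr_of_eventuallyEq
      (IsPatch.eventually_slice (variedIntegrand_chart F hr hN hu c hx))
  have := key p _ (mem_chart_target Plane p)
  rwa [(chartAt Plane p).left_inv (mem_chart_source Plane p)] at this

lemma continuous_firstVariation {F : ℝ × ℝ → ℝ} (hF : ContDiff ℝ 3 F) (hr : IsSmoothImmersion r)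
    (hN : IsUnitNormal r N) (hu : Reg ∞ u) : Continuous (firstVariation F r N u) := by
  have h1 : Continuous (laplacian r u) :=
    (Reg.laplacian (m := 0) hr hN le_rfl (by simpa using one_add_one_le_infty) hu).continuous
  have hgu : Reg 1 (grad r u) := hu.grad hr le_rfl one_add_one_le_infty
  have h2 : Reg 0 (hess r u) := Reg.covDeriv hr hN (by simp) (by simp) hgu
  have h3 := (Reg.clm traceSpace
    (Reg.clm_comp ((reg_secondForm hr hN).of_le (by simp)) h2)).continuous
  have h4 := (reg_partialH hF hr hN).continuous
  have h5 := (reg_partialK hF hr hN).continuous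
  have h6 := (reg_meanCurv hr hN).continuous
  have h7 := (reg_gaussCurv hr hN).continuous
  have h8 := hF.continuous.comp (reg_curvatures hr hN).continuous
  have h9 := hu.continuous
  exact ((h4.mul ((continuous_const.mul h1).add
    (((continuous_const.mul (h6.pow 2)).sub h7).mul h9))).add
    (h5.mul ((((continuous_const.mul h6).mul h1).sub h3).add
      (((continuous_const.mul h6).mul h7).mul h9)))).sub
    (((continuous_const.mul h6).mul h9).mul h8)

/-- Allows the integral over `C` to be replaced by the integral over all of `M`. -/
lemma firstVariation_eq_zero (F : ℝ × ℝ → ℝ) {p : M} (hp : p ∉ tsupport u) :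
    firstVariation F r N u p = 0 := by
  have h1 : ∀ q ∉ tsupport u, grad r u q = 0 := by
    intro q hq
    rw [grad, tderiv_congr r (notMem_tsupport_iff_eventuallyEq.1 hq)]
    have : tderiv r (0 : M → ℝ) q = 0 := tderiv_const r 0 q
    rw [this, map_zero]
  have h2 : grad r u =ᶠ[𝓝 p] fun _ => 0 := by
    filter_upwards [(isClosed_tsupport u).isOpen_compl.mem_nhds hp] with q hq using h1 q hq
  have h3 : hess r u p = 0 := by
    rw [hess, covDeriv, tderiv_congr r h2, tderiv_const, ContinuousLinearMap.comp_zero]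
  have h4 : laplacian r u p = 0 := by
    rw [laplacian, h3]; simp
  rw [firstVariation, h3, h4, image_eq_zero_of_notMem_tsupport hp]
  simp

end Varied

/-! ### Differentiation under the integral over a compact set -/

section Parametric

variable {M : Type*} [TopologicalSpace M] [ChartedSpace Plane M] [SecondCountableTopology M]
  [T2Space M] [MeasurableSpace M] [BorelSpace M]

/-- Differentiation under the integral over a compact set, for integrands that are `C¹` in the
parameter and the coordinates. -/
theorem hasDerivAt_setIntegral_of_contDiffAt_chart {μ : Measure M} [IsLocallyFiniteMeasure μ]
    {Φ : ℝ → M → ℝ} {Φ' : M → ℝ} {C : Set M} (hC : IsCompact C)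
    (hΦ : ∀ (c : M), ContDiffAt ℝ 1 (fun z : ℝ × Plane => Φ z.1 ((chartAt Plane c).symm z.2))
      (0, chartAt Plane c c))
    (hd : ∀ p, HasDerivAt (fun t => Φ t p) (Φ' p) 0) (hc : Continuous Φ') :
    HasDerivAt (fun t => ∫ p in C, Φ t p ∂μ) (∫ p in C, Φ' p ∂μ) 0 := by
  have : LocallyCompactSpace M := ChartedSpace.locallyCompactSpace Plane M
  -- Dominated differentiation needs one interval of parameters and one bound for all of `C`. Both
  -- are found by induction over the compact set, with minima of `ε` and maxima of `B` for unions.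
  have hloc : ∃ ε > 0, ∃ B : ℝ, ∀ q ∈ C, ∀ t ∈ Metric.ball (0 : ℝ) ε,
      DifferentiableAt ℝ (fun t => Φ t q) t ∧ ‖deriv (fun t => Φ t q) t‖ ≤ B ∧
        ContinuousAt (Φ t) q := by
    refine hC.induction_on (p := fun S => ∃ ε > 0, ∃ B : ℝ, ∀ q ∈ S, ∀ t ∈ Metric.ball (0 : ℝ) ε,
      DifferentiableAt ℝ (fun t => Φ t q) t ∧ ‖deriv (fun t => Φ t q) t‖ ≤ B ∧
        ContinuousAt (Φ t) q) ⟨1, one_pos, 0, by simp⟩ ?_ ?_ ?_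
    · rintro S S' hS ⟨ε, hε, B, h⟩
      exact ⟨ε, hε, B, fun q hq => h q (hS hq)⟩
    · rintro S S' ⟨ε, hε, B, h⟩ ⟨ε', hε', B', h'⟩
      refine ⟨min ε ε', lt_min hε hε', max B B', ?_⟩
      rintro q (hq | hq) t ht
      · have := h q hq t (Metric.ball_subset_ball (min_le_left _ _) ht)
        exact ⟨this.1, this.2.1.trans (le_max_left _ _), this.2.2⟩
      · have := h' q hq t (Metric.ball_subset_ball (min_le_right _ _) ht)
        exact ⟨this.1, this.2.1.trans (le_max_right _ _), this.2.2⟩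
    · intro c _
      set e := chartAt Plane c with he
      set f : ℝ × Plane → ℝ := fun z => Φ z.1 (e.symm z.2) with hf
      have h1 : ∀ᶠ z in 𝓝 ((0 : ℝ), e c), ContDiffAt ℝ 1 f z := (hΦ c).eventually (by simp)
      have h2 : ∀ᶠ z in 𝓝 ((0 : ℝ), e c), ‖fderiv ℝ f z‖ < ‖fderiv ℝ f (0, e c)‖ + 1 :=
        ((hΦ c).fderiv_right (m := 0) (by simp)).continuousAt.norm.eventually
          (gt_mem_nhds (lt_add_one _))
      -- Near `(0, c)` the derivative is bounded by its value there plus one; a product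
      -- neighbourhood separates the interval for `t` from the region for the point.
      obtain ⟨U, hU, W, hW, hUW⟩ := mem_nhds_prod_iff.1 (h1.and h2)
      obtain ⟨ε, hε, hεU⟩ := Metric.mem_nhds_iff.1 hU
      have hs := mem_chart_source Plane c
      refine ⟨e.source ∩ e ⁻¹' W, mem_nhdsWithin_of_mem_nhds (Filter.inter_mem
        (e.open_source.mem_nhds hs) ((e.continuousAt hs).preimage_mem_nhds hW)), ε, hε,
        (‖fderiv ℝ f (0, e c)‖ + 1) * ‖((1 : ℝ), (0 : Plane))‖, ?_⟩
      rintro q ⟨hqs, hqW⟩ t ht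
      obtain ⟨h3, h4⟩ := hUW (Set.mk_mem_prod (hεU ht) hqW)
      have h5 : (fun t => Φ t q) = fun t => f (t, e q) := by
        funext s; simp [hf, e.left_inv hqs]
      have h6 : HasDerivAt (fun t => Φ t q) (fderiv ℝ f (t, e q) (1, 0)) t := by
        rw [h5]
        exact ((h3.differentiableAt (by simp)).hasFDerivAt).comp_hasDerivAt t
          ((hasDerivAt_id t).prodMk (hasDerivAt_const t (e q)))
      refine ⟨h6.differentiableAt, ?_, ?_⟩
      · rw [h6.deriv]
        exact ((fderiv ℝ f (t, e q)).le_opNorm _).trans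
          (mul_le_mul_of_nonneg_right h4.le (norm_nonneg _))
      · have h7 : ContinuousAt (fun q => f (t, e q)) q :=
          ContinuousAt.comp (f := fun q => (t, e q)) h3.continuousAt
            (continuousAt_const.prodMk (e.continuousAt hqs))
        refine h7.congr ?_
        filter_upwards [e.open_source.mem_nhds hqs] with q' hq'
        simp [hf, e.left_inv hq']
  obtain ⟨ε, hε, B, h⟩ := hloc
  have hμC : IsFiniteMeasure (μ.restrict C) := ⟨by simpa using hC.measure_lt_top⟩
  have hcont : ∀ t ∈ Metric.ball (0 : ℝ) ε, ContinuousOn (Φ t) C :=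
    fun t ht q hq => (h q hq t ht).2.2.continuousWithinAt
  have hae : ∀ᵐ q ∂μ.restrict C, q ∈ C := ae_restrict_mem hC.measurableSet
  have hF' : (fun q => deriv (fun t => Φ t q) 0) = Φ' := funext fun q => (hd q).deriv
  have key := hasDerivAt_integral_of_dominated_loc_of_deriv_le (μ := μ.restrict C)
    (F := Φ) (F' := fun t q => deriv (fun t => Φ t q) t) (bound := fun _ => B) (x₀ := 0)
    (Metric.ball_mem_nhds (0 : ℝ) hε)
    (by
      filter_upwards [Metric.ball_mem_nhds (0 : ℝ) hε] with t ht
      exact (hcont t ht).aestronglyMeasurable hC.measurableSet)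
    ((hcont 0 (Metric.mem_ball_self hε)).integrableOn_compact hC)
    (by rw [hF']; exact hc.aestronglyMeasurable)
    (hae.mono fun q hq t ht => (h q hq t ht).2.1) (integrable_const B)
    (hae.mono fun q hq t ht => (h q hq t ht).1.hasDerivAt)
  rw [← hF']
  exact key.2

end Parametric

/-! ### The first variation formula -/

section Functional

variable {M : Type*} [TopologicalSpace M] [T2Space M] [SecondCountableTopology M]
  [ChartedSpace Plane M] [IsManifold (𝓡 2) ∞ M] [MeasurableSpace M] [BorelSpace M]
  {r N : M → Space} {u : M → ℝ}

/-- Valid for every `t`, since the density formula for the area does not need `r_t` to be an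
immersion. -/
lemma variedFunctional_eq (F : ℝ × ℝ → ℝ) (hr : IsSmoothImmersion r) (hN : IsUnitNormal r N)
    (hu : Reg ∞ u) {C : Set M} (hC : IsCompact C) (t : ℝ) :
    variedFunctional F r N u C t = ∫ p in C, variedIntegrand F r N u t p ∂(area r) := by
  have hr' := reg_normalVariation hr hN hu t
  rw [variedFunctional, functional, area_eq_withDensity hr hr',
    setIntegral_withDensity_eq_setIntegral_toReal_smul
      (continuous_areaRatio hr hr').measurable.ennreal_ofReal
      (Filter.Eventually.of_forall fun _ => ENNReal.ofReal_lt_top) _ hC.measurableSet]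
  refine integral_congr_ae (Filter.Eventually.of_forall fun p => ?_)
  simp only [variedIntegrand, smul_eq_mul]
  rw [ENNReal.toReal_ofReal (areaRatio_nonneg _ _ _), mul_comm]

/-- The first variation formula. -/
theorem hasDerivAt_variedFunctional {F : ℝ × ℝ → ℝ} (hF : ContDiff ℝ 3 F)
    (hr : IsSmoothImmersion r) (hN : IsUnitNormal r N) {C : Set M} (h : IsAdmissible u C) :
    HasDerivAt (variedFunctional F r N u C)
      (∫ p, u p * eulerLagrange F r N p ∂(area r)) 0 := by
  obtain ⟨hu, hC, huC⟩ := h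
  have := isLocallyFiniteMeasure_area hr.1
  have hus : HasCompactSupport u := hC.of_isClosed_subset (isClosed_tsupport u) huC
  rw [← integral_firstVariation hF hr hN hu hus,
    ← setIntegral_eq_integral_of_forall_compl_eq_zero (s := C)
      fun p hp => firstVariation_eq_zero F fun hpu => hp (huC hpu),
    funext fun t => variedFunctional_eq F hr hN hu hC t]
  refine hasDerivAt_setIntegral_of_contDiffAt_chart hC (fun c => ?_)
    (hasDerivAt_variedIntegrand hF hr hN hu) (continuous_firstVariation hF hr hN hu)
  have hx := mem_chart_target Plane c
  exact ((isPatch_chart hr hN hu c).contDiffAt_varDensity hx hF).congr_of_eventuallyEq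
    (variedIntegrand_chart F hr hN hu c hx)

end Functional

end ImmersedSurface

end

theorem mainTheorem9 {M : Type*} [TopologicalSpace M] [T2Space M] [SecondCountableTopology M]
    [ChartedSpace ImmersedSurface.Plane M] [IsManifold (𝓡 2) ∞ M]
    [MeasurableSpace M] [BorelSpace M]
    (r N : M → ImmersedSurface.Space)
    (hr : ImmersedSurface.IsSmoothImmersion r) (hN : ImmersedSurface.IsUnitNormal r N)
    (F : ℝ × ℝ → ℝ) (hF : ContDiff ℝ 3 F) :
    (∀ (u : M → ℝ) (C : Set M), ImmersedSurface.IsAdmissible u C →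
      HasDerivAt (ImmersedSurface.variedFunctional F r N u C)
        (∫ p, u p * ImmersedSurface.eulerLagrange F r N p ∂(ImmersedSurface.area r)) 0) ∧
    (ImmersedSurface.IsCritical F r N ↔
      ∀ p : M, ImmersedSurface.eulerLagrange F r N p = 0) := by
  have hderiv : ∀ (u : M → ℝ) (C : Set M), ImmersedSurface.IsAdmissible u C →
      HasDerivAt (ImmersedSurface.variedFunctional F r N u C)
        (∫ p, u p * ImmersedSurface.eulerLagrange F r N p ∂(ImmersedSurface.area r)) 0 :=
    fun u C h => ImmersedSurface.hasDerivAt_variedFunctional hF hr hN h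
  refine ⟨hderiv, fun hcrit => ?_, fun hE u C h => ?_⟩
  · have := ChartedSpace.locallyCompactSpace ImmersedSurface.Plane M
    have := ImmersedSurface.isLocallyFiniteMeasure_area hr.1
    have := ImmersedSurface.isOpenPosMeasure_area hr
    have hcont := ImmersedSurface.continuous_eulerLagrange hF hr hN
    have hae : ∀ᵐ p ∂(ImmersedSurface.area r), ImmersedSurface.eulerLagrange F r N p = 0 := by
      -- The fundamental lemma of the calculus of variations; each test function `u` is admissible
      -- with its own support as `C`, and uniqueness of the derivative gives the vanishing integral.
      refine ae_eq_zero_of_integral_contMDiff_smul_eq_zero (𝓡 2) hcont.locallyIntegrable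
        fun u hu hus => ?_
      have hadm : ImmersedSurface.IsAdmissible u (tsupport u) := ⟨hu, hus, subset_rfl⟩
      exact (hderiv u _ hadm).unique (hcrit u _ hadm)
    -- Two continuous functions that agree almost everywhere agree everywhere, because nonempty open
    -- sets have positive area.
    exact congrFun ((hcont.ae_eq_iff_eq _ continuous_const).1 hae)
  · simpa [hE] using hderiv u C h
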